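/- Consider a two-source M/G/1/1 status update system: sources $1$ and $2$ generate packets according to independent Poisson processes of rates $\lambda_1,\lambda_2>0$, $\lambda=\lambda_1+\lambda_2$; there is one server and no waiting room; the service times are i.i.d. copies of a random variable $S\ge 0$ with $\mathbb{E}[S]=1/\mu$, $0<\mu<\infty$, independent of the arrivals. Under the non-preemptive policy, a packet that finds the server busy is blocked and cleared, and every other packet is served to the end and then received by the sink. The state of the system at time $0$ (the time stamps most recently received by the sink and, if the server is busy, the source, the time stamp and the remaining service time of the packet in service) is arbitrary, possibly random, and independent of the packets generated after time $0$ and of their service times. Let $t_i$ and $t'_i$ be the generation time and the delivery time of the $i$th delivered packet of source $1$ among those generated after time $0$ ($i\ge 1$), let $\delta_1(t)=t-U_1(t)$ be the age of information (AoI) of source $1$, where $U_1(t)$ is the generation time of the source $1$ packet most recently received by the sink at time $t$, and let $A_{i+1}=(t'_{i+1}-t'_i)+(t'_i-t_i)$ be the peak AoI of source $1$ immediately before its $(i+1)$th delivery. Put $$\tilde\Delta_1=\frac{\lambda+\mu}{\lambda_1\mu}+\frac{\lambda\mu\,\mathbb{E}[S^2]}{2(\lambda+\mu)}\in(0,\infty],\qquad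 \tilde A_1=\frac{2\lambda_1+\lambda_2+\mu}{\lambda_1\mu}.$$ Then source $1$ has average AoI $\tilde\Delta_1$ and average peak AoI $\tilde A_1$, that is: 1. almost surely, $\lim_{T\to\infty}\frac1T\int_0^T\delta_1(t)\,\mathrm{d}t=\tilde\Delta_1$; 2. if the AoI process is stationary (it is enough that the law of $\delta_1(t)$ is the same for all $t\ge 0$), then $\mathbb{E}[\delta_1(t)]=\tilde\Delta_1$ for all $t\ge 0$; 3. $A_{i+1}$ is integrable and $\mathbb{E}[A_{i+1}]=\tilde A_1$ for every $i\ge 1$; 4. almost surely, $\lim_{n\to\infty}\frac1n\sum_{i=1}^{n}A_{i+1}=\tilde A_1$. -/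

import Mathlib

open MeasureTheory ProbabilityTheory Filter Topology

noncomputable section

/-- The random data of a two-source, single-server status update system without waiting room,
observed on the time interval `[0, ∞)`. The sources are indexed by `Fin 2`
(index `0` is "source 1", index `1` is "source 2"), and the pair `(c, n)` stands for the `n`-th
packet generated by source `c` after time `0` (counting from `n = 0`). -/
structure StatusUpdateSystem (Ω : Type*) where
  /-- `gap (c, 0)` is the generation time of the first packet of source `c`, and `gap (c, n + 1)`
  the time between the generation of its packets `n` and `n + 1`. -/
  gap : Fin 2 × ℕ → Ω → ℝ
  /-- `service p` is the service time that packet `p` needs (unused if `p` is blocked). -/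
  service : Fin 2 × ℕ → Ω → ℝ
  /-- Time until which the server is occupied by a packet already in service at time `0`;
  it is `0` if the server is idle at time `0`. -/
  busyUntil : Ω → ℝ
  /-- Source of the packet in service at time `0` (irrelevant if the server is idle). -/
  initSource : Ω → Fin 2
  /-- Generation time of the packet in service at time `0` (irrelevant if the server is idle). -/
  initGen : Ω → ℝ
  /-- `initStamp ω c` is the time stamp of the packet of source `c` that the sink has received
  most recently at time `0`. -/
  initStamp : Ω → Fin 2 → ℝ

namespace StatusUpdateSystem

variable {Ω : Type*} (M : StatusUpdateSystem Ω)

/-- Generation (= arrival) time of a packet. -/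
def genTime (p : Fin 2 × ℕ) (ω : Ω) : ℝ :=
  ∑ k ∈ Finset.range (p.2 + 1), M.gap (p.1, k) ω

/-- The first packet of source `c` that is generated after time `d`. -/
def nextOfSource (c : Fin 2) (d : ℝ) (ω : Ω) : Fin 2 × ℕ :=
  (c, sInf {n : ℕ | d < M.genTime (c, n) ω})

open Classical in
/-- The first packet of the whole system that is generated after time `d`
(simultaneous generations have probability zero). -/
def nextPacket (d : ℝ) (ω : Ω) : Fin 2 × ℕ :=
  if M.genTime (M.nextOfSource 0 d ω) ω ≤ M.genTime (M.nextOfSource 1 d ω) ω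
  then M.nextOfSource 0 d ω else M.nextOfSource 1 d ω

/-- The non-preemptive policy. `freeTime k` is the time at which the server becomes free for the
`k`-th time: it then stays idle until the next packet is generated, serves this packet to the end,
and every packet that arrives meanwhile is blocked and cleared. -/
def freeTime : ℕ → Ω → ℝ
  | 0, ω => M.busyUntil ω
  | k + 1, ω =>
      M.genTime (M.nextPacket (freeTime k ω) ω) ω + M.service (M.nextPacket (freeTime k ω) ω) ω

/-- The `k`-th packet (of any source) that is admitted to service after time `0`. Its service
ends, and it is received by the sink, at time `freeTime (k + 1)`. -/
def served (k : ℕ) (ω : Ω) : Fin 2 × ℕ :=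
  M.nextPacket (M.freeTime k ω) ω

/-- Position, in the sequence `served`, of the `i`-th packet of source `c` in that sequence. -/
def position (c : Fin 2) (i : ℕ) (ω : Ω) : ℕ :=
  Nat.nth (fun k => (M.served k ω).1 = c) i

/-- Generation time of the `i`-th delivered packet of source `c`. Delivered packets are those
generated after time `0` and not blocked; `i` counts from `0`. -/
def deliveredGen (c : Fin 2) (i : ℕ) (ω : Ω) : ℝ :=
  M.genTime (M.served (M.position c i ω) ω) ω

/-- Time at which the `i`-th delivered packet of source `c` arrives at the sink. -/
def deliveryTime (c : Fin 2) (i : ℕ) (ω : Ω) : ℝ :=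
  M.freeTime (M.position c i ω + 1) ω

/-- Number of delivered packets of source `c` that have arrived at the sink by time `t`. -/
def numDelivered (c : Fin 2) (t : ℝ) (ω : Ω) : ℕ :=
  Set.ncard {i : ℕ | M.deliveryTime c i ω ≤ t}

open Classical in
/-- Time stamp of the packet of source `c` most recently received by the sink at time `t ≥ 0`.
As long as no packet generated after time `0` has been received, this is determined by the
initial state. -/
def timeStamp (c : Fin 2) (t : ℝ) (ω : Ω) : ℝ :=
  if M.numDelivered c t ω = 0 then
    if 0 < M.busyUntil ω ∧ M.busyUntil ω ≤ t ∧ M.initSource ω = c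
    then M.initGen ω else M.initStamp ω c
  else M.deliveredGen c (M.numDelivered c t ω - 1) ω

/-- Age of information of source `c` at the sink at time `t ≥ 0`. -/
def aoi (c : Fin 2) (t : ℝ) (ω : Ω) : ℝ :=
  t - M.timeStamp c t ω

/-- Interdeparture time between the delivered packets `i` and `i + 1` of source `c`. -/
def interdeparture (c : Fin 2) (i : ℕ) (ω : Ω) : ℝ :=
  M.deliveryTime c (i + 1) ω - M.deliveryTime c i ω

/-- System time of the delivered packet `i` of source `c`. -/
def systemTime (c : Fin 2) (i : ℕ) (ω : Ω) : ℝ :=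
  M.deliveryTime c i ω - M.deliveredGen c i ω

/-- Peak age of information of source `c`: the age immediately before the delivered packet
`i + 1` is received. -/
def peakAoI (c : Fin 2) (i : ℕ) (ω : Ω) : ℝ :=
  M.interdeparture c i ω + M.systemTime c i ω

/-- The initial state of the system. -/
def initState (ω : Ω) : ℝ × Fin 2 × ℝ × (Fin 2 → ℝ) :=
  (M.busyUntil ω, M.initSource ω, M.initGen ω, M.initStamp ω)

/-- All generation gaps and all service times, as one family. -/
def primitives (j : (Fin 2 × ℕ) ⊕ (Fin 2 × ℕ)) (ω : Ω) : ℝ :=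
  Sum.elim (fun p => M.gap p ω) (fun p => M.service p ω) j

/-- The M/G/1/1 assumptions: source `c` generates packets according to a Poisson process of rate
`lam c`, the service times are i.i.d. with law `ν`, the two Poisson processes and the service
times are independent, and the (otherwise arbitrary) state at time `0` is independent of what is
generated later. -/
structure IsMG11 [MeasurableSpace Ω] (P : Measure Ω) (lam : Fin 2 → ℝ) (ν : Measure ℝ) :
    Prop where
  measurable_primitives : ∀ j, Measurable (M.primitives j)
  measurable_initState : Measurable M.initState
  gap_law : ∀ p, P.map (M.gap p) = expMeasure (lam p.1)
  service_law : ∀ p, P.map (M.service p) = ν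
  indep_primitives : iIndepFun M.primitives P
  indep_initState : IndepFun M.initState (fun ω j => M.primitives j ω) P
  busyUntil_nonneg : ∀ ω, 0 ≤ M.busyUntil ω
  initGen_nonpos : ∀ ω, M.initGen ω ≤ 0
  initStamp_nonpos : ∀ ω c, M.initStamp ω c ≤ 0

end StatusUpdateSystem

end

/-! The proof is a renewal argument. Whenever the server becomes free, memorylessness of the two
Poisson processes makes the future arrivals look as they did at the start. The triple (source, idle
time, service time) of a service cycle therefore has law `cycleLaw`: source `0` with probability `p
= lam 0 / (lam 0 + lam 1)`, an independent exponential idle time of rate `lam 0 + lam 1`, and an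
independent service time. Successive cycles are i.i.d. (`map_serviceCycle`, `map_cycles`). Grouping
cycles until one serves source `0` gives delivery cycles `(Y, S)`, where `Y` is the total length and
`S` the last service time; these are again i.i.d. (`map_deliveryCycle`, `map_deliverySeq`). Both
independence statements come from one principle, `map_unfoldSeq`: a map that produces an output
together with an independent fresh copy of its input generates i.i.d. outputs when iterated. The
initial state only shifts the starting time, because it is independent of the arrivals (`map_view`).

Pathwise, the peak is `Y (i + 1) + S i` (`peakAoI_eq`). Between deliveries `i` and `i + 1` the age
is a ramp of slope one that starts at `S i` (`aoi_eq`), so its integral there is `S i * Y (i + 1) +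
Y (i + 1) ^ 2 / 2`. The strong law and interpolation between deliveries give the time average `(E S
* E Y + E (Y ^ 2) / 2) / E Y` (`tendsto_average_aoi`).

Let `X` be the length of a service cycle and `q = 1 - p`. Conditioning on the first service cycle
gives `p * E Y = E X` and `p * E (Y ^ 2) = E (X ^ 2) + 2 * q * E X * E Y`
(`mul_lintegral_deliveryLaw`, `mul_lintegral_sq_deliveryLaw`), and `S` has law `ν`
(`map_snd_deliveryLaw`). Second moments may be infinite, so they are kept in `ENNReal` and all
subtractions are made on truncated variables.

In the stationary case the pathwise limit is identified with the mean by Tonelli, truncation and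
Fatou (`lintegral_eq_of_stationary`). -/

noncomputable section

/-! ### I.i.d. sequences and iteration of renewal maps -/

section IidSequences

variable {X Y : Type*}

/-- Prepend a term to a sequence. -/
def consSeq (p : X × (ℕ → X)) : ℕ → X
  | 0 => p.1
  | n + 1 => p.2 n

@[simp] lemma consSeq_zero (p : X × (ℕ → X)) : consSeq p 0 = p.1 := rfl

@[simp] lemma consSeq_succ (p : X × (ℕ → X)) (n : ℕ) : consSeq p (n + 1) = p.2 n := rfl

/-- The sequence of outputs obtained by iterating `Ψ`. -/
def unfoldSeq (Ψ : Y → X × Y) (y : Y) (n : ℕ) : X :=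
  (Ψ ((fun z => (Ψ z).2)^[n] y)).1

lemma unfoldSeq_succ (Ψ : Y → X × Y) (y : Y) (n : ℕ) :
    unfoldSeq Ψ y (n + 1) = unfoldSeq Ψ (Ψ y).2 n := by
  simp [unfoldSeq]

variable [MeasurableSpace X] [MeasurableSpace Y]

/-- The law of a sequence of i.i.d. random variables with law `π`. -/
abbrev iidLaw (π : Measure X) : Measure (ℕ → X) := Measure.infinitePi fun _ : ℕ => π

lemma measurable_consSeq : Measurable (consSeq : X × (ℕ → X) → ℕ → X) := by
  refine measurable_pi_iff.2 fun n => ?_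
  cases n with
  | zero => exact measurable_fst
  | succ n => exact (measurable_pi_apply n).comp measurable_snd

/-- A measure on sequences that gives the right mass to initial boxes is a product measure. -/
lemma eq_iidLaw_of_boxes {π : Measure X} [IsProbabilityMeasure π] {κ : Measure (ℕ → X)}
    (h : ∀ (n : ℕ) (t : ℕ → Set X), (∀ i, MeasurableSet (t i)) →
      κ {x | ∀ i < n, x i ∈ t i} = ∏ i ∈ Finset.range n, π (t i)) : κ = iidLaw π := by
  classical
  refine Measure.eq_infinitePi _ fun s t ht => ?_
  obtain ⟨n, hn⟩ := s.exists_nat_subset_range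
  -- Coordinates outside `s` get the side `univ`, which turns the finite box over `s` into an
  -- initial box.
  have := h n (fun i => if i ∈ s then t i else Set.univ) (fun i => by
    split_ifs; exacts [ht i, MeasurableSet.univ])
  have e : {x : ℕ → X | ∀ i < n, x i ∈ (if i ∈ s then t i else Set.univ)} = Set.pi s t := by
    ext x
    simp only [Set.mem_ofPred_eq, Set.mem_pi, Finset.mem_coe]
    constructor
    · intro hx i hi
      simpa [hi] using hx i (Finset.mem_range.1 (hn hi))
    · intro hx i _
      split_ifs with hi
      exacts [hx i hi, Set.mem_univ _]
  rw [e] at this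
  rw [this, ← Finset.prod_subset hn (f := fun i => π (if i ∈ s then t i else Set.univ))]
  · exact Finset.prod_congr rfl fun i hi => by simp [hi]
  · intro i _ hi
    simp [hi]

lemma map_consSeq (π : Measure X) [IsProbabilityMeasure π] :
    (π.prod (iidLaw π)).map consSeq = iidLaw π := by
  refine eq_iidLaw_of_boxes fun n t ht => ?_
  have hm : MeasurableSet {x : ℕ → X | ∀ i < n, x i ∈ t i} := by
    have : {x : ℕ → X | ∀ i < n, x i ∈ t i} = Set.pi (Finset.range n : Finset ℕ) t := by
      ext x; simp
    rw [this]
    exact MeasurableSet.pi (Finset.countable_toSet _) fun i _ => ht i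
  rw [Measure.map_apply measurable_consSeq hm]
  cases n with
  | zero => simp
  | succ n =>
    have : consSeq ⁻¹' {x : ℕ → X | ∀ i < n + 1, x i ∈ t i}
        = t 0 ×ˢ Set.pi (Finset.range n : Finset ℕ) (fun i => t (i + 1)) := by
      ext p
      simp only [Set.mem_preimage, Set.mem_ofPred_eq, Set.mem_prod, Set.mem_pi, Finset.coe_range,
        Set.mem_Iio]
      constructor
      · exact fun h => ⟨h 0 (by omega), fun i hi => h (i + 1) (by omega)⟩
      · rintro ⟨h0, h⟩ i hi
        cases i with
        | zero => exact h0
        | succ i => exact h i (by omega)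
    rw [this, Measure.prod_prod, Measure.infinitePi_pi _ fun i _ => ht (i + 1),
      Finset.prod_range_succ', mul_comm]

/-- Conditioning on the first term; all later inductions on hitting and crossing indices rest on it.
-/
lemma lintegral_iidLaw (π : Measure X) [IsProbabilityMeasure π] {f : (ℕ → X) → ENNReal}
    (hf : Measurable f) :
    ∫⁻ x, f x ∂(iidLaw π) = ∫⁻ a, ∫⁻ x, f (consSeq (a, x)) ∂(iidLaw π) ∂π := by
  conv_lhs => rw [← map_consSeq π]
  rw [lintegral_map hf measurable_consSeq,
    lintegral_prod (fun p => f (consSeq p)) (hf.comp measurable_consSeq).aemeasurable]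

lemma measurable_unfoldSeq {Ψ : Y → X × Y} (hΨ : Measurable Ψ) : Measurable (unfoldSeq Ψ) := by
  refine measurable_pi_iff.2 fun n => ?_
  exact (hΨ.comp ((measurable_snd.comp hΨ).iterate n)).fst

/-- If `Ψ` turns a random element with law `Q` into an output with law `ρ` and an independent copy
of the random element, then the outputs of the iteration are i.i.d. -/
lemma map_unfoldSeq {Ψ : Y → X × Y} (hΨ : Measurable Ψ) {Q : Measure Y} [IsProbabilityMeasure Q]
    {ρ : Measure X} [IsProbabilityMeasure ρ] (h : Q.map Ψ = ρ.prod Q) :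
    Q.map (unfoldSeq Ψ) = iidLaw ρ := by
  have hm : ∀ (n : ℕ) (t : ℕ → Set X), (∀ i, MeasurableSet (t i)) →
      MeasurableSet {x : ℕ → X | ∀ i < n, x i ∈ t i} := by
    intro n t ht
    have : {x : ℕ → X | ∀ i < n, x i ∈ t i} = Set.pi (Finset.range n : Finset ℕ) t := by
      ext x; simp
    rw [this]
    exact MeasurableSet.pi (Finset.countable_toSet _) fun i _ => ht i
  refine eq_iidLaw_of_boxes fun n => ?_
  induction n with
  | zero =>
    intro t ht
    rw [Measure.map_apply (measurable_unfoldSeq hΨ) (hm 0 t ht)]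
    simp
  | succ n ih =>
    intro t ht
    have hu := measurable_unfoldSeq hΨ
    have := ih (fun i => t (i + 1)) fun i => ht (i + 1)
    rw [Measure.map_apply hu (hm n _ fun i => ht (i + 1))] at this
    -- The first output is independent of the state it leaves behind, so the box factors into its
    -- first side and a box for the iteration restarted from that state.
    rw [Measure.map_apply hu (hm _ t ht), Finset.prod_range_succ', ← this, mul_comm,
      ← Measure.prod_prod, ← h, Measure.map_apply hΨ
        ((ht 0).prod (hu (hm n _ fun i => ht (i + 1))))]
    congr 1
    ext y
    simp only [Set.mem_preimage, Set.mem_ofPred_eq, Set.mem_prod]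
    constructor
    · exact fun hy => ⟨hy 0 (by omega), fun i hi => by
        rw [← unfoldSeq_succ]; exact hy (i + 1) (by omega)⟩
    · rintro ⟨h0, hy⟩ i hi
      cases i with
      | zero => exact h0
      | succ i => rw [unfoldSeq_succ]; exact hy i (by omega)

end IidSequences

/-! ### Measurability of random indices -/

section RandomIndices

variable {Y : Type*} [MeasurableSpace Y]

lemma measurable_sInf_nat {p : ℕ → Y → Prop} (hp : ∀ n, MeasurableSet {y | p n y}) :
    Measurable fun y => sInf {n : ℕ | p n y} := by
  classical
  refine measurable_to_countable' fun n => ?_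
  have hleast : MeasurableSet {y | p n y ∧ ∀ m < n, ¬ p m y} := by
    have : {y | p n y ∧ ∀ m < n, ¬ p m y} = {y | p n y} ∩ ⋂ m ∈ Finset.range n, {y | p m y}ᶜ := by
      ext y; simp
    rw [this]
    exact (hp n).inter (Finset.measurableSet_biInter _ fun m _ => (hp m).compl)
  -- The infimum of the empty set is `0`, so the level set of `0` contains this additional event.
  have hnone : MeasurableSet {y | n = 0 ∧ ∀ m, ¬ p m y} := by
    have : {y | n = 0 ∧ ∀ m, ¬ p m y} = {y | n = 0} ∩ ⋂ m, {y | p m y}ᶜ := by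
      ext y; simp
    rw [this]
    exact (MeasurableSet.const _).inter (MeasurableSet.iInter fun m => (hp m).compl)
  convert hleast.union hnone using 1
  ext y
  simp only [Set.mem_preimage, Set.mem_singleton_iff, Set.mem_union, Set.mem_ofPred_eq]
  by_cases hy : ∃ m, p m y
  · have hne : {m | p m y}.Nonempty := hy
    constructor
    · rintro rfl
      exact Or.inl ⟨Nat.sInf_mem hne, fun m hm => Nat.notMem_of_lt_sInf hm⟩
    · rintro (⟨h1, h2⟩ | ⟨_, h⟩)
      · exact le_antisymm (Nat.sInf_le h1) (not_lt.1 fun hlt => h2 _ hlt (Nat.sInf_mem hne))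
      · obtain ⟨m, hm⟩ := hy
        exact absurd hm (h m)
  · push Not at hy
    simp [hy, eq_comm]

lemma measurable_apply_countable {ι Z : Type*} [Countable ι] [MeasurableSpace ι]
    [MeasurableSingletonClass ι] [MeasurableSpace Z] {f : ι → Y → Z}
    (hf : ∀ n, Measurable (f n)) {N : Y → ι} (hN : Measurable N) :
    Measurable fun y => f (N y) y :=
  (measurable_from_prod_countable_right (f := fun p : ι × Y => f p.1 p.2) hf).comp
    (hN.prodMk measurable_id)

lemma measurable_nth {p : ℕ → Y → Prop} (hp : ∀ n, MeasurableSet {y | p n y}) (i : ℕ) :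
    Measurable fun y => Nat.nth (fun n => p n y) i := by
  induction i using Nat.strong_induction_on with
  | _ i ih =>
    simp_rw [Nat.nth_eq_sInf _ i]
    refine measurable_sInf_nat fun n => ?_
    have : {y | p n y ∧ ∀ k < i, Nat.nth (fun n => p n y) k < n}
        = {y | p n y} ∩ ⋂ k ∈ Finset.range i, {y | Nat.nth (fun n => p n y) k < n} := by
      ext y; simp
    rw [this]
    exact (hp n).inter (Finset.measurableSet_biInter _ fun k hk =>
      measurableSet_lt (ih k (Finset.mem_range.1 hk)) measurable_const)

end RandomIndices

/-! ### The exponential distribution: memorylessness and moments -/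

section Exponential

lemma lintegral_expMeasure (r : ℝ) {f : ℝ → ENNReal} (hf : Measurable f) :
    ∫⁻ g, f g ∂(expMeasure r) = ∫⁻ g, exponentialPDF r g * f g := by
  have hm : Measurable (exponentialPDF r) := (measurable_exponentialPDFReal r).ennreal_ofReal
  exact lintegral_withDensity_eq_lintegral_mul volume hm hf

instance nullSingletonClass_expMeasure (r : ℝ) : NullSingletonClass (expMeasure r) :=
  inferInstanceAs (NullSingletonClass (volume.withDensity _))

/-- Memorylessness of the exponential distribution. -/
lemma lintegral_expMeasure_sub {r : ℝ} {d : ℝ} (hd : 0 ≤ d) {f : ℝ → ENNReal}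
    (hf : Measurable f) :
    ∫⁻ g, (if d < g then f (g - d) else 0) ∂(expMeasure r)
      = ENNReal.ofReal (Real.exp (-(r * d))) * ∫⁻ g, f g ∂(expMeasure r) := by
  have hm : Measurable (exponentialPDF r) := (measurable_exponentialPDFReal r).ennreal_ofReal
  rw [lintegral_expMeasure r hf, lintegral_expMeasure r
    (f := fun g => if d < g then f (g - d) else 0)
    (Measurable.ite measurableSet_Ioi (hf.comp (measurable_id.sub_const d)) measurable_const),
    ← lintegral_add_right_eq_self _ d, ← lintegral_const_mul _ (f := fun g => exponentialPDF r g * f g) (hm.mul hf)]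
  refine lintegral_congr_ae ?_
  -- At `g = 0` the indicator vanishes while the density need not, so this point is discarded.
  filter_upwards [Measure.ae_ne volume (0 : ℝ)] with g hg
  simp only [add_sub_cancel_right, lt_add_iff_pos_left]
  split_ifs with h
  · rw [exponentialPDF_of_nonneg (by linarith), exponentialPDF_of_nonneg h.le, ← mul_assoc,
      ← ENNReal.ofReal_mul (Real.exp_pos _).le]
    congr 2
    rw [show -(r * (g + d)) = -(r * d) + -(r * g) by ring, Real.exp_add]
    ring
  · rw [exponentialPDF_of_neg (lt_of_le_of_ne (not_lt.1 h) hg)]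
    simp

/-- Both the strict and the weak form are needed: `cycleHead` resolves ties in favour of source `0`,
so the two sources win under different inequalities. -/
lemma lintegral_expMeasure_sub_le {r : ℝ} {d : ℝ} (hd : 0 ≤ d) {f : ℝ → ENNReal}
    (hf : Measurable f) :
    ∫⁻ g, (if d ≤ g then f (g - d) else 0) ∂(expMeasure r)
      = ENNReal.ofReal (Real.exp (-(r * d))) * ∫⁻ g, f g ∂(expMeasure r) := by
  rw [← lintegral_expMeasure_sub hd hf]
  refine lintegral_congr_ae ?_
  filter_upwards [Measure.ae_ne (expMeasure r) d] with g hg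
  simp [lt_iff_le_and_ne, hg.symm]

lemma ae_expMeasure_pos {r : ℝ} (hr : 0 < r) : ∀ᵐ g ∂(expMeasure r), 0 < g := by
  have := isProbabilityMeasure_expMeasure hr
  have h := lintegral_expMeasure_sub (r := r) le_rfl (measurable_const (a := (1 : ENNReal)))
  have e : (fun g : ℝ => if 0 < g then (1 : ENNReal) else 0) = (Set.Ioi 0).indicator 1 := by
    ext g; simp [Set.indicator_apply]
  rw [e, lintegral_indicator_one measurableSet_Ioi] at h
  simp only [mul_zero, neg_zero, Real.exp_zero, ENNReal.ofReal_one, lintegral_const, measure_univ,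
    mul_one] at h
  exact (prob_compl_eq_zero_iff measurableSet_Ioi).2 h

/-- Multiplied by `g ^ k`, the exponential density is a constant multiple of the Gamma density of
shape `k + 1`, which has total mass one. -/
lemma lintegral_expMeasure_gamma {r : ℝ} (hr : 0 < r) (k : ℕ) :
    ∫⁻ g, ENNReal.ofReal (g ^ k) ∂(expMeasure r) = ENNReal.ofReal (k.factorial / r ^ k) := by
  rw [lintegral_expMeasure r (by fun_prop)]
  have hk1 : (0 : ℝ) < k + 1 := by positivity
  have : ∀ g : ℝ, exponentialPDF r g * ENNReal.ofReal (g ^ k)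
      = ENNReal.ofReal (k.factorial / r ^ k) * gammaPDF (k + 1) r g := by
    intro g
    rcases lt_or_ge g 0 with hg | hg
    · rw [exponentialPDF_of_neg hg, gammaPDF_of_neg hg]; simp
    · rw [exponentialPDF_of_nonneg hg, gammaPDF_of_nonneg hg, ← ENNReal.ofReal_mul (by positivity),
        ← ENNReal.ofReal_mul (by positivity)]
      congr 1
      rw [Real.Gamma_nat_eq_factorial, add_sub_cancel_right, Real.rpow_natCast,
        Real.rpow_add_one hr.ne', Real.rpow_natCast]
      have : (k.factorial : ℝ) ≠ 0 := by positivity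
      field_simp
  simp_rw [this]
  rw [lintegral_const_mul _ (show Measurable (gammaPDF (k + 1) r) from
      (measurable_gammaPDFReal _ _).ennreal_ofReal),
    lintegral_gammaPDF_eq_one hk1 hr, mul_one]

end Exponential

/-! ### Pathwise calculus of a marked point process seen from a later time -/

section Residual

/-- Time of the `n`-th point of the point process with gaps `(x k).1`. -/
def pointTime (x : ℕ → ℝ × ℝ) (n : ℕ) : ℝ := ∑ k ∈ Finset.range (n + 1), (x k).1

/-- Index of the first point after `d`. -/
def crossing (d : ℝ) (x : ℕ → ℝ × ℝ) : ℕ := sInf {n | d < pointTime x n}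

/-- The marked point process seen from time `d` onwards. -/
def residualSeq (d : ℝ) (x : ℕ → ℝ × ℝ) (j : ℕ) : ℝ × ℝ :=
  (if j = 0 then pointTime x (crossing d x) - d else (x (crossing d x + j)).1,
    (x (crossing d x + j)).2)

/-- The `n`-th point is the first one after `d`. -/
def CrossesAt (d : ℝ) (x : ℕ → ℝ × ℝ) (n : ℕ) : Prop :=
  d < pointTime x n ∧ ∀ m < n, pointTime x m ≤ d

lemma CrossesAt.crossing_eq {d : ℝ} {x : ℕ → ℝ × ℝ} {n : ℕ} (h : CrossesAt d x n) :
    crossing d x = n :=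
  le_antisymm (Nat.sInf_le h.1)
    (le_csInf ⟨n, h.1⟩ fun m hm => not_lt.1 fun hlt => (h.2 m hlt).not_gt hm)

lemma crossesAt_crossing {d : ℝ} {x : ℕ → ℝ × ℝ} (h : ∃ n, d < pointTime x n) :
    CrossesAt d x (crossing d x) :=
  ⟨Nat.sInf_mem h, fun _ hm => not_lt.1 fun hlt => Nat.notMem_of_lt_sInf hm hlt⟩

@[simp] lemma pointTime_zero (x : ℕ → ℝ × ℝ) : pointTime x 0 = (x 0).1 := by simp [pointTime]

lemma pointTime_consSeq_succ (p : (ℝ × ℝ) × (ℕ → ℝ × ℝ)) (n : ℕ) :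
    pointTime (consSeq p) (n + 1) = p.1.1 + pointTime p.2 n := by
  rw [pointTime, Finset.sum_range_succ', add_comm]
  rfl

lemma crossesAt_consSeq_zero {d : ℝ} {p : (ℝ × ℝ) × (ℕ → ℝ × ℝ)} :
    CrossesAt d (consSeq p) 0 ↔ d < p.1.1 := by
  simp [CrossesAt]

lemma crossesAt_consSeq_succ {d : ℝ} {p : (ℝ × ℝ) × (ℕ → ℝ × ℝ)} {n : ℕ} :
    CrossesAt d (consSeq p) (n + 1) ↔ p.1.1 ≤ d ∧ CrossesAt (d - p.1.1) p.2 n := by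
  simp only [CrossesAt, pointTime_consSeq_succ, sub_lt_iff_lt_add']
  constructor
  · rintro ⟨h, h'⟩
    refine ⟨by simpa using h' 0 (by omega), h, fun m hm => ?_⟩
    have := h' (m + 1) (by omega)
    rw [pointTime_consSeq_succ] at this
    linarith
  · rintro ⟨h0, h, h'⟩
    refine ⟨h, fun m hm => ?_⟩
    cases m with
    | zero => simpa using h0
    | succ m =>
      have := h' m (by omega)
      rw [pointTime_consSeq_succ]
      linarith

lemma residualSeq_consSeq_of_lt {d : ℝ} {p : (ℝ × ℝ) × (ℕ → ℝ × ℝ)} (h : d < p.1.1) :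
    residualSeq d (consSeq p) = consSeq ((p.1.1 - d, p.1.2), p.2) := by
  have hc := (crossesAt_consSeq_zero.2 h).crossing_eq
  ext1 j
  cases j <;> simp [residualSeq, hc]

lemma residualSeq_consSeq_of_crossesAt {d : ℝ} {p : (ℝ × ℝ) × (ℕ → ℝ × ℝ)} {n : ℕ} (h : p.1.1 ≤ d)
    (hn : CrossesAt (d - p.1.1) p.2 n) :
    residualSeq d (consSeq p) = residualSeq (d - p.1.1) p.2 := by
  have hc := (crossesAt_consSeq_succ.2 ⟨h, hn⟩).crossing_eq
  ext1 j
  simp only [residualSeq, hc, hn.crossing_eq, pointTime_consSeq_succ,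
    show n + 1 + j = (n + j) + 1 by omega, consSeq_succ]
  congr 2
  ring

/-- Moving the time origin by `a` only shortens the first gap. -/
lemma residualSeq_add_consSeq (a b g s : ℝ) (t : ℕ → ℝ × ℝ) :
    residualSeq (a + b) (consSeq ((g, s), t)) = residualSeq b (consSeq ((g - a, s), t)) := by
  have hp : ∀ n, pointTime (consSeq ((g - a, s), t)) n = pointTime (consSeq ((g, s), t)) n - a := by
    intro n
    cases n with
    | zero => simp
    | succ n => rw [pointTime_consSeq_succ, pointTime_consSeq_succ]; dsimp only; ring
  have hc : crossing (a + b) (consSeq ((g, s), t)) = crossing b (consSeq ((g - a, s), t)) := by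
    simp only [crossing, hp]
    congr 1
    ext n
    simp only [Set.mem_ofPred_eq]
    constructor <;> intro h <;> linarith
  ext1 j
  simp only [residualSeq, hc, hp]
  cases h : crossing b (consSeq ((g - a, s), t)) + j with
  | zero =>
    have : j = 0 := by omega
    simp [this, sub_sub]
  | succ m => simp only [consSeq_succ, sub_sub]

lemma pointTime_residualSeq (d : ℝ) (x : ℕ → ℝ × ℝ) (n : ℕ) :
    pointTime (residualSeq d x) n = pointTime x (crossing d x + n) - d := by
  induction n with
  | zero => simp [residualSeq]
  | succ n ih =>
    rw [pointTime, Finset.sum_range_succ, ← pointTime, ih, ← add_assoc, pointTime, pointTime,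
      Finset.sum_range_succ (n := crossing d x + n + 1)]
    simp only [residualSeq, Nat.add_eq_zero_iff, one_ne_zero, and_false, if_false]
    rw [add_assoc (crossing d x)]
    ring

/-- Semigroup property of the shift in time. It lets the view from one free time of the server be
computed from the view at the preceding one. The existence hypothesis keeps the infima in `crossing`
away from their default value. -/
lemma residualSeq_residualSeq {d e : ℝ} (he : 0 ≤ e) {x : ℕ → ℝ × ℝ}
    (hx : ∃ n, d + e < pointTime x n) :
    residualSeq e (residualSeq d x) = residualSeq (d + e) x := by
  have h1 := crossesAt_crossing hx
  have h2 : CrossesAt d x (crossing d x) :=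
    crossesAt_crossing (hx.imp fun n hn => by linarith)
  have hle : crossing d x ≤ crossing (d + e) x :=
    not_lt.1 fun hlt => absurd h1.1 (not_lt.2 (by have := h2.2 _ hlt; linarith))
  have hc : crossing e (residualSeq d x) = crossing (d + e) x - crossing d x := by
    refine CrossesAt.crossing_eq ⟨?_, fun m hm => ?_⟩
    · rw [pointTime_residualSeq, Nat.add_sub_cancel' hle]
      linarith [h1.1]
    · rw [pointTime_residualSeq]
      linarith [h1.2 (crossing d x + m) (by omega)]
  ext1 j
  have hj : crossing d x + (crossing (d + e) x - crossing d x + j) = crossing (d + e) x + j := by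
    omega
  rw [residualSeq, hc, pointTime_residualSeq, Nat.add_sub_cancel' hle]
  simp only [residualSeq, hj]
  congr 1
  by_cases h0 : j = 0
  · simp only [h0, if_true]; ring
  · simp [h0]

lemma measurable_pointTime (n : ℕ) : Measurable fun x : ℕ → ℝ × ℝ => pointTime x n := by
  unfold pointTime
  fun_prop

lemma measurable_crossing : Measurable fun p : ℝ × (ℕ → ℝ × ℝ) => crossing p.1 p.2 :=
  measurable_sInf_nat fun n =>
    measurableSet_lt measurable_fst ((measurable_pointTime n).comp measurable_snd)

lemma measurable_residualSeq : Measurable fun p : ℝ × (ℕ → ℝ × ℝ) => residualSeq p.1 p.2 := by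
  refine measurable_pi_iff.2 fun j => ?_
  have h : ∀ n, Measurable fun p : ℝ × (ℕ → ℝ × ℝ) =>
      ((if j = 0 then pointTime p.2 n - p.1 else (p.2 (n + j)).1, (p.2 (n + j)).2) : ℝ × ℝ) := by
    intro n
    have : Measurable fun p : ℝ × (ℕ → ℝ × ℝ) => pointTime p.2 n :=
      (measurable_pointTime n).comp measurable_snd
    split_ifs <;> fun_prop
  exact measurable_apply_countable h measurable_crossing

lemma measurableSet_crossesAt (n : ℕ) :
    MeasurableSet {p : ℝ × (ℕ → ℝ × ℝ) | CrossesAt p.1 p.2 n} := by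
  have h : ∀ m, Measurable fun p : ℝ × (ℕ → ℝ × ℝ) => pointTime p.2 m :=
    fun m => (measurable_pointTime m).comp measurable_snd
  have : {p : ℝ × (ℕ → ℝ × ℝ) | CrossesAt p.1 p.2 n} = {p | p.1 < pointTime p.2 n} ∩
      ⋂ m ∈ Finset.range n, {p | pointTime p.2 m ≤ p.1} := by
    ext p; simp [CrossesAt]
  rw [this]
  exact (measurableSet_lt measurable_fst (h n)).inter
    (Finset.measurableSet_biInter _ fun m _ => measurableSet_le (h m) measurable_fst)

end Residual

/-! ### Strong law on the sequence space -/

section StrongLaw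

variable {X : Type*} [MeasurableSpace X]

lemma strong_law_iidLaw (π : Measure X) [IsProbabilityMeasure π] {g : X → ℝ} (hg : Measurable g)
    (hint : Integrable g π) :
    ∀ᵐ x ∂(iidLaw π), Tendsto (fun n : ℕ => (∑ i ∈ Finset.range n, g (x i)) / (n : ℝ)) atTop
      (𝓝 (∫ a, g a ∂π)) := by
  have hev : ∀ i : ℕ, MeasurePreserving (fun x : ℕ → X => x i) (iidLaw π) π :=
    fun i => measurePreserving_eval_infinitePi (fun _ : ℕ => π) i
  have hindep : iIndepFun (fun (i : ℕ) (x : ℕ → X) => g (x i)) (iidLaw π) :=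
    iIndepFun_infinitePi (P := fun _ : ℕ => π) (X := fun _ => g) fun _ => hg
  have h := strong_law_ae_real (μ := iidLaw π) (fun (i : ℕ) (x : ℕ → X) => g (x i))
    ((hev 0).integrable_comp_of_integrable hint)
    (fun i j hij => hindep.indepFun hij)
    (fun i => by
      refine ⟨(hg.comp (measurable_pi_apply i)).aemeasurable,
        (hg.comp (measurable_pi_apply 0)).aemeasurable, ?_⟩
      change Measure.map (g ∘ fun x : ℕ → X => x i) _ = Measure.map (g ∘ fun x : ℕ → X => x 0) _
      rw [← Measure.map_map hg (measurable_pi_apply i), ← Measure.map_map hg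
        (measurable_pi_apply 0), (hev i).map_eq, (hev 0).map_eq])
  have e : ∫ x, g (x 0) ∂(iidLaw π) = ∫ a, g a ∂π := by
    conv_rhs => rw [← (hev 0).map_eq, integral_map (measurable_pi_apply 0).aemeasurable
      hg.aestronglyMeasurable]
  rw [e] at h
  exact h

end StrongLaw

/-! ### Restarting a marked Poisson process at a fixed time -/

section PoissonProcess

variable {r : ℝ} {ν : Measure ℝ} [IsProbabilityMeasure ν]

/-- The law of a Poisson process of rate `r` with i.i.d. marks of law `ν`, given by its gaps
and marks. -/
abbrev poissonLaw (r : ℝ) (ν : Measure ℝ) : Measure (ℕ → ℝ × ℝ) :=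
  iidLaw ((expMeasure r).prod ν)

lemma integral_expMeasure {r : ℝ} (hr : 0 < r) :
    Integrable (fun g => g) (expMeasure r) ∧ ∫ g, g ∂(expMeasure r) = 1 / r := by
  have h := lintegral_expMeasure_gamma hr 1
  have h0 : 0 ≤ᵐ[expMeasure r] fun g => g := by
    filter_upwards [ae_expMeasure_pos hr] with g hg using hg.le
  simp only [pow_one, Nat.factorial_one, Nat.cast_one] at h
  have hi : Integrable (fun g => g) (expMeasure r) := by
    refine ⟨aestronglyMeasurable_id, ?_⟩
    rw [hasFiniteIntegral_iff_ofReal h0, h]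
    exact ENNReal.ofReal_lt_top
  refine ⟨hi, ?_⟩
  rw [integral_eq_lintegral_of_nonneg_ae h0 aestronglyMeasurable_id, h,
    ENNReal.toReal_ofReal (by positivity)]

/-- By the strong law the `n`-th point time grows like `n / r`, hence exceeds every bound. -/
lemma ae_poissonLaw_exists_lt (hr : 0 < r) :
    ∀ᵐ x ∂(poissonLaw r ν), ∀ d, ∃ n, d < pointTime x n := by
  have := isProbabilityMeasure_expMeasure hr
  obtain ⟨hi, he⟩ := integral_expMeasure hr
  have hl := strong_law_iidLaw ((expMeasure r).prod ν) measurable_fst (hi.comp_fst ν)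
  have he' : ∫ a : ℝ × ℝ, a.1 ∂((expMeasure r).prod ν) = 1 / r := by
    rw [← he, integral_fun_fst (fun g : ℝ => g)]
    simp
  rw [he'] at hl
  filter_upwards [hl] with x hx d
  have h1 : Tendsto (fun n : ℕ => (∑ i ∈ Finset.range n, (x i).1) / (n : ℝ) * n) atTop atTop :=
    hx.pos_mul_atTop (by positivity) tendsto_natCast_atTop_atTop
  obtain ⟨n, hn, hn0⟩ := ((h1.eventually_gt_atTop d).and (eventually_gt_atTop 0)).exists
  rw [div_mul_cancel₀ _ (by positivity)] at hn
  refine ⟨n - 1, ?_⟩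
  rwa [pointTime, Nat.sub_add_cancel hn0]

/-- Memorylessness of the first gap carries over to the whole sequence, since its mark and the later
terms are independent of it. The relation `R` stands for `<` or `≤`. -/
lemma lintegral_poissonLaw_shift (hr : 0 < r) {R : ℝ → ℝ → Prop} [DecidableRel R] {d : ℝ}
    (hR : ∀ f : ℝ → ENNReal, Measurable f → ∫⁻ g, (if R d g then f (g - d) else 0) ∂(expMeasure r)
      = ENNReal.ofReal (Real.exp (-(r * d))) * ∫⁻ g, f g ∂(expMeasure r))
    (hRm : MeasurableSet {g | R d g})
    {f : (ℕ → ℝ × ℝ) → ENNReal} (hf : Measurable f) :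
    ∫⁻ a, ∫⁻ x, (if R d a.1 then f (consSeq ((a.1 - d, a.2), x)) else 0)
        ∂(poissonLaw r ν) ∂((expMeasure r).prod ν)
      = ENNReal.ofReal (Real.exp (-(r * d))) * ∫⁻ x, f x ∂(poissonLaw r ν) := by
  have := isProbabilityMeasure_expMeasure hr
  have hF : Measurable fun a : ℝ × ℝ => ∫⁻ x, f (consSeq (a, x)) ∂(poissonLaw r ν) :=
    (hf.comp measurable_consSeq).lintegral_prod_right'
  have h1 : ∀ a : ℝ × ℝ,
      ∫⁻ x, (if R d a.1 then f (consSeq ((a.1 - d, a.2), x)) else 0) ∂(poissonLaw r ν)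
      = if R d a.1 then ∫⁻ x, f (consSeq ((a.1 - d, a.2), x)) ∂(poissonLaw r ν) else 0 := by
    intro a; split_ifs <;> simp
  simp_rw [h1]
  rw [lintegral_iidLaw _ hf, lintegral_prod _ hF.aemeasurable, lintegral_prod]
  · rw [← hR _ hF.lintegral_prod_right']
    refine lintegral_congr fun g => ?_
    split_ifs <;> simp
  · refine (Measurable.ite (hRm.preimage measurable_fst) ?_ measurable_const).aemeasurable
    exact hF.comp (by fun_prop : Measurable fun a : ℝ × ℝ => (a.1 - d, a.2))

open Classical in
-- The number of points up to `d` is independent of what is seen from `d` on. For `n = 0` this is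
-- memorylessness of the first gap; otherwise one conditions on that gap `g ≤ d` and applies
-- induction with the remaining time `d - g`.
lemma lintegral_poissonLaw_crossesAt (hr : 0 < r) (n : ℕ) {d : ℝ} (hd : 0 ≤ d)
    {f : (ℕ → ℝ × ℝ) → ENNReal} (hf : Measurable f) :
    ∫⁻ x, (if CrossesAt d x n then f (residualSeq d x) else 0) ∂(poissonLaw r ν)
      = (∫⁻ x, (if CrossesAt d x n then 1 else 0) ∂(poissonLaw r ν)) *
        ∫⁻ x, f x ∂(poissonLaw r ν) := by
  have := isProbabilityMeasure_expMeasure hr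
  have hm : ∀ (n : ℕ) (d : ℝ) (f : (ℕ → ℝ × ℝ) → ENNReal), Measurable f →
      Measurable fun x => if CrossesAt d x n then f (residualSeq d x) else 0 := by
    intro n d f hf
    have h : Measurable fun x : ℕ → ℝ × ℝ => (d, x) := by fun_prop
    exact Measurable.ite ((measurableSet_crossesAt n).preimage h)
      (hf.comp (measurable_residualSeq.comp h)) measurable_const
  have zero : ∀ f : (ℕ → ℝ × ℝ) → ENNReal, Measurable f → ∀ d, 0 ≤ d →
      ∫⁻ x, (if CrossesAt d x 0 then f (residualSeq d x) else 0) ∂(poissonLaw r ν)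
      = ENNReal.ofReal (Real.exp (-(r * d))) * ∫⁻ x, f x ∂(poissonLaw r ν) := by
    intro f hf d hd
    rw [lintegral_iidLaw _ (hm 0 d f hf), ← lintegral_poissonLaw_shift hr (R := (· < ·))
      (fun f hf => lintegral_expMeasure_sub hd hf) measurableSet_Ioi hf]
    refine lintegral_congr fun a => lintegral_congr fun x => ?_
    simp only [crossesAt_consSeq_zero]
    split_ifs with h
    · rw [residualSeq_consSeq_of_lt h]
    · rfl
  induction n generalizing d with
  | zero =>
    rw [zero f hf d hd, zero _ measurable_const d hd]
    simp
  | succ n ih =>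
    have succ : ∀ f : (ℕ → ℝ × ℝ) → ENNReal, Measurable f →
        ∫⁻ x, (if CrossesAt d x (n + 1) then f (residualSeq d x) else 0) ∂(poissonLaw r ν)
        = ∫⁻ a, (if a.1 ≤ d then ∫⁻ x, (if CrossesAt (d - a.1) x n then
            f (residualSeq (d - a.1) x) else 0) ∂(poissonLaw r ν) else 0)
          ∂((expMeasure r).prod ν) := by
      intro f hf
      rw [lintegral_iidLaw _ (hm _ d f hf)]
      refine lintegral_congr fun a => ?_
      simp only [crossesAt_consSeq_succ]
      split_ifs with h
      · refine lintegral_congr fun x => ?_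
        simp only [h, true_and]
        split_ifs with h'
        · rw [residualSeq_consSeq_of_crossesAt h h']
        · rfl
      · simp [h]
    have hm1 : Measurable fun a : ℝ × ℝ => if a.1 ≤ d then
        ∫⁻ x, (if CrossesAt (d - a.1) x n then 1 else 0) ∂(poissonLaw r ν) else 0 := by
      refine Measurable.ite (measurableSet_le measurable_fst measurable_const) ?_ measurable_const
      refine Measurable.lintegral_prod_right' (f := fun p : (ℝ × ℝ) × (ℕ → ℝ × ℝ) =>
        if CrossesAt (d - p.1.1) p.2 n then (1 : ENNReal) else 0) ?_
      refine Measurable.ite ?_ measurable_const measurable_const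
      exact (measurableSet_crossesAt n).preimage (by fun_prop :
        Measurable fun p : (ℝ × ℝ) × (ℕ → ℝ × ℝ) => (d - p.1.1, p.2))
    rw [succ f hf, succ _ measurable_const, ← lintegral_mul_const _ hm1]
    refine lintegral_congr fun a => ?_
    split_ifs with h
    · exact ih (sub_nonneg.2 h)
    · simp

/-- The points of a Poisson process after a fixed time form a Poisson process. -/
lemma lintegral_residualSeq (hr : 0 < r) {d : ℝ} (hd : 0 ≤ d) {f : (ℕ → ℝ × ℝ) → ENNReal}
    (hf : Measurable f) :
    ∫⁻ x, f (residualSeq d x) ∂(poissonLaw r ν) = ∫⁻ x, f x ∂(poissonLaw r ν) := by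
  classical
  have := isProbabilityMeasure_expMeasure hr
  have hm : ∀ (n : ℕ) (f : (ℕ → ℝ × ℝ) → ENNReal), Measurable f →
      Measurable fun x => if CrossesAt d x n then f (residualSeq d x) else 0 := by
    intro n f hf
    have h : Measurable fun x : ℕ → ℝ × ℝ => (d, x) := by fun_prop
    exact Measurable.ite ((measurableSet_crossesAt n).preimage h)
      (hf.comp (measurable_residualSeq.comp h)) measurable_const
  have key : ∀ f : (ℕ → ℝ × ℝ) → ENNReal, Measurable f →
      ∫⁻ x, f (residualSeq d x) ∂(poissonLaw r ν)
      = ∑' n, ∫⁻ x, (if CrossesAt d x n then f (residualSeq d x) else 0) ∂(poissonLaw r ν) := by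
    intro f hf
    rw [← lintegral_tsum fun n => (hm n f hf).aemeasurable]
    refine lintegral_congr_ae ?_
    filter_upwards [ae_poissonLaw_exists_lt (ν := ν) hr] with x hx
    rw [tsum_eq_single (crossing d x) fun n hn => if_neg fun h => hn h.crossing_eq.symm,
      if_pos (crossesAt_crossing (hx d))]
  -- For `f = 1` the decomposition says that the crossing probabilities sum to one.
  have h1 := key _ (measurable_const (a := (1 : ENNReal)))
  rw [key f hf]
  simp_rw [fun n => lintegral_poissonLaw_crossesAt (ν := ν) hr n hd hf]
  rw [ENNReal.tsum_mul_right, ← h1]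
  simp

end PoissonProcess

/-! ### One service cycle: the race between two Poisson processes -/

section ServiceCycle

open Classical in
/-- Source of the next packet, time until its generation, and its mark, for two marked point
processes. -/
def cycleHead (z : (ℕ → ℝ × ℝ) × (ℕ → ℝ × ℝ)) : Fin 2 × ℝ × ℝ :=
  if (z.1 0).1 ≤ (z.2 0).1 then (0, z.1 0) else (1, z.2 0)

/-- The next packet, and the two processes seen from the end of its service. -/
def serviceCycle (z : (ℕ → ℝ × ℝ) × (ℕ → ℝ × ℝ)) :
    (Fin 2 × ℝ × ℝ) × (ℕ → ℝ × ℝ) × (ℕ → ℝ × ℝ) :=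
  (cycleHead z, residualSeq ((cycleHead z).2.1 + (cycleHead z).2.2) z.1,
    residualSeq ((cycleHead z).2.1 + (cycleHead z).2.2) z.2)

/-- The law of the source of a packet in the superposition of two Poisson processes. -/
def sourceLaw (a b : ℝ) : Measure (Fin 2) :=
  ENNReal.ofReal (a / (a + b)) • Measure.dirac 0 + ENNReal.ofReal (b / (a + b)) • Measure.dirac 1

lemma lintegral_sourceLaw (a b : ℝ) (f : Fin 2 → ENNReal) :
    ∫⁻ c, f c ∂(sourceLaw a b)
      = ENNReal.ofReal (a / (a + b)) * f 0 + ENNReal.ofReal (b / (a + b)) * f 1 := by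
  simp [sourceLaw]

lemma isProbabilityMeasure_sourceLaw {a b : ℝ} (ha : 0 < a) (hb : 0 < b) :
    IsProbabilityMeasure (sourceLaw a b) := by
  constructor
  rw [← lintegral_one, lintegral_sourceLaw, mul_one, mul_one,
    ← ENNReal.ofReal_add (by positivity) (by positivity), ← add_div, div_self (by positivity),
    ENNReal.ofReal_one]

/-- The law of (source, idle time, service time) for one cycle of the server. -/
abbrev cycleLaw (a b : ℝ) (ν : Measure ℝ) : Measure (Fin 2 × ℝ × ℝ) :=
  (sourceLaw a b).prod ((expMeasure (a + b)).prod ν)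

lemma lintegral_cycleLaw {a b : ℝ} (ha : 0 < a) (hb : 0 < b) {ν : Measure ℝ}
    [IsProbabilityMeasure ν] {f : Fin 2 × ℝ × ℝ → ENNReal} (hf : Measurable f) :
    ∫⁻ p, f p ∂(cycleLaw a b ν)
      = ENNReal.ofReal (a / (a + b)) * ∫⁻ p, f (0, p) ∂((expMeasure (a + b)).prod ν)
        + ENNReal.ofReal (b / (a + b)) * ∫⁻ p, f (1, p) ∂((expMeasure (a + b)).prod ν) := by
  have := isProbabilityMeasure_sourceLaw ha hb
  have := isProbabilityMeasure_expMeasure (add_pos ha hb)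
  rw [lintegral_prod _ hf.aemeasurable, lintegral_sourceLaw]

lemma measurable_cycleHead : Measurable cycleHead := by
  refine Measurable.ite (measurableSet_le ?_ ?_) ?_ ?_ <;> fun_prop

lemma measurable_serviceCycle : Measurable serviceCycle := by
  have h := measurable_cycleHead
  refine h.prodMk (.prodMk ?_ ?_)
  · exact measurable_residualSeq.comp (f := fun z : (ℕ → ℝ × ℝ) × (ℕ → ℝ × ℝ) =>
      ((cycleHead z).2.1 + (cycleHead z).2.2, z.1)) (by fun_prop)
  · exact measurable_residualSeq.comp (f := fun z : (ℕ → ℝ × ℝ) × (ℕ → ℝ × ℝ) =>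
      ((cycleHead z).2.1 + (cycleHead z).2.2, z.2)) (by fun_prop)

/-- The factor `exp (-(b * g))` is the chance that a clock of rate `b` has not rung by time `g`. On
the event that the clock of rate `a` wins, the winning time thus has rate `a + b`, with total weight
`a / (a + b)`. -/
lemma lintegral_exp_mul_expMeasure {a b : ℝ} (ha : 0 < a) (hb : 0 < b) {f : ℝ → ENNReal}
    (hf : Measurable f) :
    ∫⁻ g, ENNReal.ofReal (Real.exp (-(b * g))) * f g ∂(expMeasure a)
      = ENNReal.ofReal (a / (a + b)) * ∫⁻ g, f g ∂(expMeasure (a + b)) := by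
  have hm : Measurable (exponentialPDF (a + b)) :=
    (measurable_exponentialPDFReal (a + b)).ennreal_ofReal
  rw [lintegral_expMeasure _ hf, lintegral_expMeasure _ (by fun_prop),
    ← lintegral_const_mul _ (f := fun g => exponentialPDF (a + b) g * f g) (hm.mul hf)]
  refine lintegral_congr fun g => ?_
  rcases lt_or_ge g 0 with hg | hg
  · simp [exponentialPDF_of_neg hg]
  · rw [exponentialPDF_of_nonneg hg, exponentialPDF_of_nonneg hg, ← mul_assoc, ← mul_assoc,
      ← ENNReal.ofReal_mul (by positivity), ← ENNReal.ofReal_mul (by positivity)]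
    congr 2
    rw [show -((a + b) * g) = -(a * g) + -(b * g) by ring, Real.exp_add]
    field_simp

variable {a b : ℝ} {ν : Measure ℝ} [IsProbabilityMeasure ν]

/-- This treats the losing source: given no arrival before the winner's time `d`, its process
restarts at `d`, and then once more after the service time `e`. -/
lemma lintegral_poissonLaw_shift_residualSeq (hb : 0 < b) {R : ℝ → ℝ → Prop} [DecidableRel R]
    {d e : ℝ} (he : 0 ≤ e)
    (hR : ∀ f : ℝ → ENNReal, Measurable f → ∫⁻ g, (if R d g then f (g - d) else 0) ∂(expMeasure b)
      = ENNReal.ofReal (Real.exp (-(b * d))) * ∫⁻ g, f g ∂(expMeasure b))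
    (hRm : MeasurableSet {g | R d g})
    {f : (ℕ → ℝ × ℝ) → ENNReal} (hf : Measurable f) :
    ∫⁻ y, (if R d (y 0).1 then f (residualSeq (d + e) y) else 0) ∂(poissonLaw b ν)
      = ENNReal.ofReal (Real.exp (-(b * d))) * ∫⁻ y, f y ∂(poissonLaw b ν) := by
  have := isProbabilityMeasure_expMeasure hb
  have hres : ∀ c, Measurable fun y => f (residualSeq c y) := fun c =>
    hf.comp (measurable_residualSeq.comp measurable_prodMk_left)
  calc ∫⁻ y, (if R d (y 0).1 then f (residualSeq (d + e) y) else 0) ∂(poissonLaw b ν)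
      = ∫⁻ q, ∫⁻ y, (if R d q.1 then f (residualSeq e (consSeq ((q.1 - d, q.2), y))) else 0)
          ∂(poissonLaw b ν) ∂((expMeasure b).prod ν) := by
        rw [lintegral_iidLaw]
        · refine lintegral_congr fun q => lintegral_congr fun y => ?_
          rw [consSeq_zero, ← residualSeq_add_consSeq]
        · exact Measurable.ite (hRm.preimage (f := fun y : ℕ → ℝ × ℝ => (y 0).1) (by fun_prop))
            (hres _) measurable_const
    _ = ENNReal.ofReal (Real.exp (-(b * d))) * ∫⁻ y, f (residualSeq e y) ∂(poissonLaw b ν) :=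
        lintegral_poissonLaw_shift hb hR hRm (hres e)
    _ = _ := by rw [lintegral_residualSeq hb he hf]

/-- The process `x` wins. Given its first gap and mark, both processes restart at the end of the
service; the loser contributes the weight `exp (-(b * g))`, which tilts the winning gap from rate
`a` to rate `a + b`. -/
lemma lintegral_poissonLaw_race (ha : 0 < a) (hb : 0 < b) (hν : ∀ᵐ s ∂ν, 0 ≤ s)
    {R : ℝ → ℝ → Prop} [DecidableRel R]
    (hR : ∀ d, 0 ≤ d → ∀ f : ℝ → ENNReal, Measurable f →
      ∫⁻ g, (if R d g then f (g - d) else 0) ∂(expMeasure b)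
      = ENNReal.ofReal (Real.exp (-(b * d))) * ∫⁻ g, f g ∂(expMeasure b))
    (hRm : MeasurableSet {p : ℝ × ℝ | R p.1 p.2})
    {G : (ℝ × ℝ) × (ℕ → ℝ × ℝ) × (ℕ → ℝ × ℝ) → ENNReal} (hG : Measurable G) :
    ∫⁻ x, ∫⁻ y, (if R (x 0).1 (y 0).1 then
        G (x 0, residualSeq ((x 0).1 + (x 0).2) x, residualSeq ((x 0).1 + (x 0).2) y) else 0)
        ∂(poissonLaw b ν) ∂(poissonLaw a ν)
      = ENNReal.ofReal (a / (a + b)) * ∫⁻ p, ∫⁻ x, ∫⁻ y, G (p, x, y)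
        ∂(poissonLaw b ν) ∂(poissonLaw a ν) ∂((expMeasure (a + b)).prod ν) := by
  have := isProbabilityMeasure_expMeasure ha
  have := isProbabilityMeasure_expMeasure hb
  have := isProbabilityMeasure_expMeasure (add_pos ha hb)
  have hGy : Measurable fun q : (ℝ × ℝ) × (ℕ → ℝ × ℝ) =>
      ∫⁻ y, G (q.1, q.2, y) ∂(poissonLaw b ν) :=
    Measurable.lintegral_prod_right' (f := fun q : ((ℝ × ℝ) × (ℕ → ℝ × ℝ)) × (ℕ → ℝ × ℝ) =>
      G (q.1.1, q.1.2, q.2)) (by fun_prop)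
  have hGxy : Measurable fun p : ℝ × ℝ =>
      ∫⁻ x, ∫⁻ y, G (p, x, y) ∂(poissonLaw b ν) ∂(poissonLaw a ν) := hGy.lintegral_prod_right'
  have hint : Measurable fun q : (ℕ → ℝ × ℝ) × (ℕ → ℝ × ℝ) => if R (q.1 0).1 (q.2 0).1 then
      G (q.1 0, residualSeq ((q.1 0).1 + (q.1 0).2) q.1,
        residualSeq ((q.1 0).1 + (q.1 0).2) q.2) else 0 := by
    refine Measurable.ite (hRm.preimage (f := fun q : (ℕ → ℝ × ℝ) × (ℕ → ℝ × ℝ) =>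
      ((q.1 0).1, (q.2 0).1)) (by fun_prop)) (hG.comp (.prodMk (by fun_prop) (.prodMk ?_ ?_)))
      measurable_const
    · exact measurable_residualSeq.comp (f := fun z : (ℕ → ℝ × ℝ) × (ℕ → ℝ × ℝ) =>
        ((z.1 0).1 + (z.1 0).2, z.1)) (by fun_prop)
    · exact measurable_residualSeq.comp (f := fun z : (ℕ → ℝ × ℝ) × (ℕ → ℝ × ℝ) =>
        ((z.1 0).1 + (z.1 0).2, z.2)) (by fun_prop)
  rw [lintegral_iidLaw _ hint.lintegral_prod_right', lintegral_prod _ hGxy.aemeasurable,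
    ← lintegral_exp_mul_expMeasure ha hb hGxy.lintegral_prod_right']
  have hpos : ∀ᵐ p : ℝ × ℝ ∂((expMeasure a).prod ν), 0 < p.1 ∧ 0 ≤ p.2 := by
    have h1 := Measure.quasiMeasurePreserving_fst (μ := expMeasure a) (ν := ν) |>.ae
      (ae_expMeasure_pos ha)
    have h2 := Measure.quasiMeasurePreserving_snd (μ := expMeasure a) (ν := ν) |>.ae hν
    filter_upwards [h1, h2] with p h1 h2 using ⟨h1, h2⟩
  have key : ∀ᵐ p : ℝ × ℝ ∂((expMeasure a).prod ν),
      ∫⁻ t, ∫⁻ y, (if R (consSeq (p, t) 0).1 (y 0).1 then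
        G (consSeq (p, t) 0, residualSeq ((consSeq (p, t) 0).1 + (consSeq (p, t) 0).2)
          (consSeq (p, t)), residualSeq ((consSeq (p, t) 0).1 + (consSeq (p, t) 0).2) y) else 0)
        ∂(poissonLaw b ν) ∂(poissonLaw a ν)
      = ENNReal.ofReal (Real.exp (-(b * p.1))) *
        ∫⁻ x, ∫⁻ y, G (p, x, y) ∂(poissonLaw b ν) ∂(poissonLaw a ν) := by
    filter_upwards [hpos] with p ⟨hp1, hp2⟩
    have hGp : Measurable fun t => ∫⁻ y, G (p, t, y) ∂(poissonLaw b ν) :=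
      hGy.comp measurable_prodMk_left
    rw [← lintegral_residualSeq ha hp2 hGp, ← lintegral_const_mul]
    swap
    · exact hGp.comp (measurable_residualSeq.comp measurable_prodMk_left)
    refine lintegral_congr_ae ?_
    filter_upwards [ae_poissonLaw_exists_lt (ν := ν) ha] with t ht
    simp only [consSeq_zero]
    -- The winner's own first point lies before the end of its service and drops out of the view.
    have e1 : residualSeq (p.1 + p.2) (consSeq (p, t)) = residualSeq p.2 t := by
      have h := crossesAt_crossing (ht p.2)
      have := residualSeq_consSeq_of_crossesAt (d := p.1 + p.2) (p := (p, t))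
        (n := crossing p.2 t) (by dsimp only; linarith) (by simpa using h)
      simpa using this
    rw [e1]
    exact lintegral_poissonLaw_shift_residualSeq hb hp2 (hR p.1 hp1.le)
      (hRm.preimage measurable_prodMk_left) (f := fun y => G (p, residualSeq p.2 t, y))
      (by fun_prop)
  rw [lintegral_congr_ae key, lintegral_prod]
  · refine lintegral_congr fun g => ?_
    have h : Measurable fun s => ∫⁻ x, ∫⁻ y, G ((g, s), x, y) ∂(poissonLaw b ν) ∂(poissonLaw a ν) :=
      hGxy.comp measurable_prodMk_left
    exact lintegral_const_mul (ENNReal.ofReal (Real.exp (-(b * g)))) h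
  · exact ((by fun_prop : Measurable fun p : ℝ × ℝ =>
      ENNReal.ofReal (Real.exp (-(b * p.1)))).mul hGxy).aemeasurable

/-- The data of one cycle of the server are independent of what follows it. -/
lemma map_serviceCycle (ha : 0 < a) (hb : 0 < b) (hν : ∀ᵐ s ∂ν, 0 ≤ s) :
    ((poissonLaw a ν).prod (poissonLaw b ν)).map serviceCycle
      = (cycleLaw a b ν).prod ((poissonLaw a ν).prod (poissonLaw b ν)) := by
  classical
  have := isProbabilityMeasure_expMeasure ha
  have := isProbabilityMeasure_expMeasure hb
  have := isProbabilityMeasure_expMeasure (add_pos ha hb)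
  have := isProbabilityMeasure_sourceLaw ha hb
  refine Measure.ext_of_lintegral _ fun f hf => ?_
  rw [lintegral_map hf measurable_serviceCycle,
    lintegral_prod (fun z => f (serviceCycle z)) (hf.comp measurable_serviceCycle).aemeasurable,
    lintegral_prod _ hf.aemeasurable,
    lintegral_cycleLaw ha hb hf.lintegral_prod_right']
  have hres : ∀ g : (ℕ → ℝ × ℝ) × (ℕ → ℝ × ℝ) → ℝ × ℝ, Measurable g →
      Measurable fun z : (ℕ → ℝ × ℝ) × (ℕ → ℝ × ℝ) =>
        (residualSeq ((g z).1 + (g z).2) z.1, residualSeq ((g z).1 + (g z).2) z.2) := by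
    intro g hg
    exact .prodMk (measurable_residualSeq.comp (f := fun z : (ℕ → ℝ × ℝ) × (ℕ → ℝ × ℝ) =>
      ((g z).1 + (g z).2, z.1)) (by fun_prop)) (measurable_residualSeq.comp
      (f := fun z : (ℕ → ℝ × ℝ) × (ℕ → ℝ × ℝ) => ((g z).1 + (g z).2, z.2)) (by fun_prop))
  -- `A` and `B` split the integral according to the winner; ties belong to `A`, as in `cycleHead`.
  let A : (ℕ → ℝ × ℝ) → (ℕ → ℝ × ℝ) → ENNReal := fun x y => if (x 0).1 ≤ (y 0).1 then
    f ((0, x 0), (residualSeq ((x 0).1 + (x 0).2) x, residualSeq ((x 0).1 + (x 0).2) y)) else 0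
  let B : (ℕ → ℝ × ℝ) → (ℕ → ℝ × ℝ) → ENNReal := fun x y => if (y 0).1 < (x 0).1 then
    f ((1, y 0), (residualSeq ((y 0).1 + (y 0).2) x, residualSeq ((y 0).1 + (y 0).2) y)) else 0
  have hA : Measurable (Function.uncurry A) := by
    refine Measurable.ite (measurableSet_le ?_ ?_) (hf.comp (.prodMk ?_
      (hres (fun z => z.1 0) (by fun_prop)))) measurable_const <;> fun_prop
  have hB : Measurable (Function.uncurry B) := by
    refine Measurable.ite (measurableSet_lt ?_ ?_) (hf.comp (.prodMk ?_
      (hres (fun z => z.2 0) (by fun_prop)))) measurable_const <;> fun_prop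
  have hsplit : ∀ x y, f (serviceCycle (x, y)) = A x y + B x y := by
    intro x y
    by_cases h : (x 0).1 ≤ (y 0).1
    · simp [A, B, serviceCycle, cycleHead, h, h.not_gt]
    · simp [A, B, serviceCycle, cycleHead, h, not_le.1 h]
  have h0 : ∫⁻ x, ∫⁻ y, A x y ∂(poissonLaw b ν) ∂(poissonLaw a ν) = _ :=
    lintegral_poissonLaw_race ha hb hν (R := fun s t => s ≤ t)
      (fun d hd f hf => lintegral_expMeasure_sub_le hd hf) measurableSet_le'
      (G := fun q => f ((0, q.1), (q.2.1, q.2.2))) (by fun_prop)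
  -- The same race with the roles exchanged: the winner is integrated on the outside, so the order
  -- of integration in `B` is swapped below.
  have h1 : ∫⁻ y, ∫⁻ x, B x y ∂(poissonLaw a ν) ∂(poissonLaw b ν) = _ :=
    lintegral_poissonLaw_race hb ha hν (R := fun s t => s < t)
      (fun d hd f hf => lintegral_expMeasure_sub hd hf) measurableSet_lt'
      (G := fun q => f ((1, q.1), (q.2.2, q.2.1))) (by fun_prop)
  simp_rw [hsplit]
  have hAx : ∀ x, Measurable (A x) := fun x => hA.comp measurable_prodMk_left
  simp_rw [fun x => lintegral_add_left (μ := poissonLaw b ν) (hAx x) (B x)]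
  rw [lintegral_add_left (f := fun x => ∫⁻ y, A x y ∂(poissonLaw b ν)) hA.lintegral_prod_right',
    lintegral_lintegral_swap hB.aemeasurable, h0, h1, add_comm b a]
  congr 2
  · refine lintegral_congr fun p => ?_
    exact (lintegral_prod (fun z => f ((0, p), z)) (by fun_prop)).symm
  · refine lintegral_congr fun p => ?_
    exact (lintegral_prod_symm (fun z => f ((1, p), z)) (by fun_prop)).symm

end ServiceCycle

/-! ### Grouping service cycles into delivery cycles -/

section DeliveryCycle

/-- The first cycle whose packet comes from source `0`. -/
def firstHit (x : ℕ → Fin 2 × ℝ × ℝ) : ℕ := sInf {n | (x n).1 = 0}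

/-- The total length of the cycles up to `n`, and the service time in cycle `n`. -/
def cycleBlock (n : ℕ) (x : ℕ → Fin 2 × ℝ × ℝ) : ℝ × ℝ :=
  (∑ k ∈ Finset.range (n + 1), ((x k).2.1 + (x k).2.2), (x n).2.2)

/-- The cycles until the first delivery from source `0`, and the cycles that follow. -/
def deliveryCycle (x : ℕ → Fin 2 × ℝ × ℝ) : (ℝ × ℝ) × (ℕ → Fin 2 × ℝ × ℝ) :=
  (cycleBlock (firstHit x) x, fun j => x (firstHit x + 1 + j))

/-- The first packet of source `0` is served in cycle `n`. -/
def HitsAt (x : ℕ → Fin 2 × ℝ × ℝ) (n : ℕ) : Prop := (x n).1 = 0 ∧ ∀ m < n, (x m).1 ≠ 0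

lemma HitsAt.firstHit_eq {x : ℕ → Fin 2 × ℝ × ℝ} {n : ℕ} (h : HitsAt x n) : firstHit x = n :=
  le_antisymm (Nat.sInf_le h.1)
    (le_csInf ⟨n, h.1⟩ fun m hm => not_lt.1 fun hlt => h.2 m hlt hm)

lemma hitsAt_firstHit {x : ℕ → Fin 2 × ℝ × ℝ} (h : ∃ n, (x n).1 = 0) : HitsAt x (firstHit x) :=
  ⟨Nat.sInf_mem h, fun _ hm => Nat.notMem_of_lt_sInf hm⟩

lemma hitsAt_consSeq_zero {p : (Fin 2 × ℝ × ℝ) × (ℕ → Fin 2 × ℝ × ℝ)} :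
    HitsAt (consSeq p) 0 ↔ p.1.1 = 0 := by
  simp [HitsAt]

lemma hitsAt_consSeq_succ {p : (Fin 2 × ℝ × ℝ) × (ℕ → Fin 2 × ℝ × ℝ)} {n : ℕ} :
    HitsAt (consSeq p) (n + 1) ↔ p.1.1 ≠ 0 ∧ HitsAt p.2 n := by
  simp only [HitsAt, consSeq_succ]
  constructor
  · rintro ⟨h, h'⟩
    exact ⟨h' 0 (by omega), h, fun m hm => h' (m + 1) (by omega)⟩
  · rintro ⟨h0, h, h'⟩
    refine ⟨h, fun m hm => ?_⟩
    cases m with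
    | zero => exact h0
    | succ m => exact h' m (by omega)

lemma cycleBlock_zero (x : ℕ → Fin 2 × ℝ × ℝ) :
    cycleBlock 0 x = ((x 0).2.1 + (x 0).2.2, (x 0).2.2) := by
  simp [cycleBlock]

lemma cycleBlock_consSeq_succ (p : (Fin 2 × ℝ × ℝ) × (ℕ → Fin 2 × ℝ × ℝ)) (n : ℕ) :
    cycleBlock (n + 1) (consSeq p)
      = (p.1.2.1 + p.1.2.2 + (cycleBlock n p.2).1, (cycleBlock n p.2).2) := by
  simp only [cycleBlock, Finset.sum_range_succ' _ (n + 1), consSeq_succ, consSeq_zero]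
  rw [add_comm]

lemma measurable_cycleBlock (n : ℕ) : Measurable (cycleBlock n) := by
  unfold cycleBlock
  fun_prop

lemma measurable_firstHit : Measurable firstHit :=
  measurable_sInf_nat fun n => (measurableSet_singleton (0 : Fin 2)).preimage
    (f := fun x : ℕ → Fin 2 × ℝ × ℝ => (x n).1) (by fun_prop)

lemma measurable_deliveryCycle : Measurable deliveryCycle :=
  (measurable_apply_countable measurable_cycleBlock measurable_firstHit).prodMk
    (measurable_pi_iff.2 fun j => measurable_apply_countable
      (f := fun (n : ℕ) (x : ℕ → Fin 2 × ℝ × ℝ) => x (n + 1 + j)) (fun n => by fun_prop)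
      measurable_firstHit)

lemma measurableSet_hitsAt (n : ℕ) : MeasurableSet {x | HitsAt x n} := by
  have h : ∀ m, MeasurableSet {x : ℕ → Fin 2 × ℝ × ℝ | (x m).1 = 0} := fun m =>
    (measurableSet_singleton (0 : Fin 2)).preimage
      (f := fun x : ℕ → Fin 2 × ℝ × ℝ => (x m).1) (by fun_prop)
  have : {x | HitsAt x n} = {x | (x n).1 = 0} ∩ ⋂ m ∈ Finset.range n, {x | (x m).1 = 0}ᶜ := by
    ext x; simp [HitsAt]
  rw [this]
  exact (h n).inter (Finset.measurableSet_biInter _ fun m _ => (h m).compl)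

/-- The law of (length, final service time) of a delivery cycle. -/
def deliveryLaw (ρ : Measure (Fin 2 × ℝ × ℝ)) : Measure (ℝ × ℝ) :=
  (iidLaw ρ).map fun x => (deliveryCycle x).1

lemma lintegral_deliveryLaw {ρ : Measure (Fin 2 × ℝ × ℝ)} {F : ℝ × ℝ → ENNReal} (hF : Measurable F) :
    ∫⁻ w, F w ∂(deliveryLaw ρ) = ∫⁻ x, F (deliveryCycle x).1 ∂(iidLaw ρ) :=
  lintegral_map hF measurable_deliveryCycle.fst

variable {ρ : Measure (Fin 2 × ℝ × ℝ)} [IsProbabilityMeasure ρ]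

/-- Without a hit all empirical frequencies would be zero, whereas the strong law makes them
converge to a positive probability. -/
lemma ae_exists_hit (hρ : ρ {p | p.1 = 0} ≠ 0) : ∀ᵐ x ∂(iidLaw ρ), ∃ n, (x n).1 = 0 := by
  have hm : MeasurableSet {p : Fin 2 × ℝ × ℝ | p.1 = 0} :=
    (measurableSet_singleton (0 : Fin 2)).preimage measurable_fst
  have h := strong_law_iidLaw ρ (g := {p | p.1 = 0}.indicator (1 : Fin 2 × ℝ × ℝ → ℝ)) (measurable_one.indicator hm)
    ((integrable_const 1).indicator hm)
  rw [integral_indicator_one hm] at h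
  filter_upwards [h] with x hx
  by_contra! hno
  have : ∀ n : ℕ, (∑ i ∈ Finset.range n, ({p | p.1 = 0}.indicator 1 (x i) : ℝ)) / (n : ℝ) = 0 := by
    intro n
    rw [Finset.sum_eq_zero, zero_div]
    intro i _
    exact Set.indicator_of_notMem (s := {p : Fin 2 × ℝ × ℝ | p.1 = 0}) (hno i) _
  simp_rw [this] at hx
  have h0 := tendsto_nhds_unique hx tendsto_const_nhds
  exact hρ ((measureReal_eq_zero_iff).1 h0)

open Classical in
-- Renewal at the hitting index: the event and the block depend on the terms up to `n` only. In the
-- induction the length of the first cycle is absorbed into `F`.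
lemma lintegral_hitsAt (n : ℕ) {F : ℝ × ℝ → ENNReal} (hF : Measurable F)
    {f : (ℕ → Fin 2 × ℝ × ℝ) → ENNReal} (hf : Measurable f) :
    ∫⁻ x, (if HitsAt x n then F (cycleBlock n x) * f (fun j => x (n + 1 + j)) else 0) ∂(iidLaw ρ)
      = (∫⁻ x, (if HitsAt x n then F (cycleBlock n x) else 0) ∂(iidLaw ρ)) *
        ∫⁻ x, f x ∂(iidLaw ρ) := by
  have hm1 : ∀ (n : ℕ) (F : ℝ × ℝ → ENNReal), Measurable F →
      Measurable fun x => if HitsAt x n then F (cycleBlock n x) else 0 := fun n F hF =>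
    Measurable.ite (measurableSet_hitsAt n) (hF.comp (measurable_cycleBlock n)) measurable_const
  have hm2 : ∀ (n : ℕ) (F : ℝ × ℝ → ENNReal), Measurable F →
      Measurable fun x : ℕ → Fin 2 × ℝ × ℝ =>
        if HitsAt x n then F (cycleBlock n x) * f (fun j => x (n + 1 + j)) else 0 := fun n F hF =>
    Measurable.ite (measurableSet_hitsAt n) ((hF.comp (measurable_cycleBlock n)).mul
      (hf.comp (by fun_prop : Measurable fun (x : ℕ → Fin 2 × ℝ × ℝ) j => x (n + 1 + j))))
      measurable_const
  have hme : Measurable fun p : (Fin 2 × ℝ × ℝ) × (ℕ → Fin 2 × ℝ × ℝ) => consSeq p :=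
    measurable_consSeq
  induction n generalizing F with
  | zero =>
    rw [lintegral_iidLaw _ (hm1 0 F hF), lintegral_iidLaw _ (hm2 0 F hF), ← lintegral_mul_const]
    swap
    · exact ((hm1 0 F hF).comp hme).lintegral_prod_right'
    refine lintegral_congr fun a => ?_
    simp only [hitsAt_consSeq_zero, cycleBlock_zero, consSeq_zero]
    by_cases h : a.1 = 0
    · simp only [h, if_true, zero_add, add_comm 1, consSeq_succ]
      rw [lintegral_const_mul _ hf]
      simp
    · simp [h]
  | succ n ih =>
    rw [lintegral_iidLaw _ (hm1 _ F hF), lintegral_iidLaw _ (hm2 _ F hF), ← lintegral_mul_const]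
    swap
    · exact ((hm1 _ F hF).comp hme).lintegral_prod_right'
    refine lintegral_congr fun a => ?_
    simp only [hitsAt_consSeq_succ, cycleBlock_consSeq_succ,
      show ∀ j, n + 1 + 1 + j = (n + 1 + j) + 1 by intro j; omega, consSeq_succ]
    by_cases h : a.1 = 0
    · simp [h]
    · simp only [ne_eq, h, not_false_eq_true, true_and]
      exact ih (F := fun w => F (a.2.1 + a.2.2 + w.1, w.2)) (by fun_prop)

instance isProbabilityMeasure_deliveryLaw : IsProbabilityMeasure (deliveryLaw ρ) :=
  Measure.isProbabilityMeasure_map measurable_deliveryCycle.fst.aemeasurable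

open Classical in
-- Decomposition by the value of `firstHit`; sequences without a hit, where `firstHit` is a default
-- value, form a null set.
lemma lintegral_eq_tsum_hitsAt (hρ : ρ {p | p.1 = 0} ≠ 0)
    {F : ℕ → (ℕ → Fin 2 × ℝ × ℝ) → ENNReal} (hF : ∀ n, Measurable (F n)) :
    ∫⁻ x, F (firstHit x) x ∂(iidLaw ρ)
      = ∑' n, ∫⁻ x, (if HitsAt x n then F n x else 0) ∂(iidLaw ρ) := by
  rw [← lintegral_tsum fun n =>
    (Measurable.ite (measurableSet_hitsAt n) (hF n) measurable_const).aemeasurable]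
  refine lintegral_congr_ae ?_
  filter_upwards [ae_exists_hit hρ] with x hx
  rw [tsum_eq_single (firstHit x) fun n hn => if_neg fun h => hn h.firstHit_eq.symm,
    if_pos (hitsAt_firstHit hx)]

/-- A delivery cycle is independent of what follows it. -/
lemma map_deliveryCycle (hρ : ρ {p | p.1 = 0} ≠ 0) :
    (iidLaw ρ).map deliveryCycle = (deliveryLaw ρ).prod (iidLaw ρ) := by
  classical
  symm
  refine Measure.prod_eq fun s t hs ht => ?_
  have h1 : Measurable (s.indicator (1 : ℝ × ℝ → ENNReal)) := measurable_one.indicator hs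
  have h2 : Measurable (t.indicator (1 : (ℕ → Fin 2 × ℝ × ℝ) → ENNReal)) :=
    measurable_one.indicator ht
  have hprod : ∀ p : (ℝ × ℝ) × (ℕ → Fin 2 × ℝ × ℝ), (s ×ˢ t).indicator (1 : (ℝ × ℝ) × (ℕ → Fin 2 × ℝ × ℝ) → ENNReal) p
      = s.indicator 1 p.1 * t.indicator 1 p.2 := by
    intro p
    by_cases hp1 : p.1 ∈ s <;> by_cases hp2 : p.2 ∈ t <;> simp [hp1, hp2]
  have hshift : ∀ n, Measurable fun (x : ℕ → Fin 2 × ℝ × ℝ) j => x (n + 1 + j) :=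
    fun n => by fun_prop
  rw [← lintegral_indicator_one (hs.prod ht), lintegral_map
    (measurable_one.indicator (hs.prod ht)) measurable_deliveryCycle,
    ← lintegral_indicator_one hs, ← lintegral_indicator_one ht, lintegral_deliveryLaw h1]
  simp only [hprod, deliveryCycle]
  rw [lintegral_eq_tsum_hitsAt hρ (F := fun n x => s.indicator 1 (cycleBlock n x)
      * t.indicator 1 (fun j => x (n + 1 + j)))
      fun n => (h1.comp (measurable_cycleBlock n)).mul (h2.comp (hshift n)),
    lintegral_eq_tsum_hitsAt hρ (F := fun n x => s.indicator 1 (cycleBlock n x))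
      fun n => h1.comp (measurable_cycleBlock n), ← ENNReal.tsum_mul_right]
  exact tsum_congr fun n => lintegral_hitsAt n h1 h2

open Classical in
-- First-step analysis: the first service cycle either ends the delivery cycle or is followed by a
-- fresh one, lengthened by that first cycle. It is the source of all moment equations.
lemma lintegral_deliveryLaw_rec (hρ : ρ {p | p.1 = 0} ≠ 0) {F : ℝ × ℝ → ENNReal}
    (hF : Measurable F) :
    ∫⁻ w, F w ∂(deliveryLaw ρ) = ∫⁻ a, (if a.1 = 0 then F (a.2.1 + a.2.2, a.2.2)
      else ∫⁻ w, F (a.2.1 + a.2.2 + w.1, w.2) ∂(deliveryLaw ρ)) ∂ρ := by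
  rw [lintegral_deliveryLaw hF,
    lintegral_iidLaw (f := fun x => F (deliveryCycle x).1) _ (hF.comp measurable_deliveryCycle.fst)]
  refine lintegral_congr fun a => ?_
  split_ifs with h
  · have : ∀ x, F (deliveryCycle (consSeq (a, x))).1 = F (a.2.1 + a.2.2, a.2.2) := by
      intro x
      simp [deliveryCycle, (hitsAt_consSeq_zero (p := (a, x)).2 h).firstHit_eq,
        cycleBlock_zero]
    simp [this]
  · rw [lintegral_deliveryLaw (F := fun w => F (a.2.1 + a.2.2 + w.1, w.2)) (by fun_prop)]
    refine lintegral_congr_ae ?_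
    filter_upwards [ae_exists_hit hρ] with x hx
    simp [deliveryCycle, (hitsAt_consSeq_succ (p := (a, x)).2 ⟨h,
      hitsAt_firstHit hx⟩).firstHit_eq, cycleBlock_consSeq_succ]

end DeliveryCycle

/-! ### Moments of a delivery cycle -/

section Moments

/-- Solving the linear equation satisfied by a moment of a geometric sum. -/
lemma ENNReal.mul_eq_of_truncated {p q e c : ENNReal} (hp0 : p ≠ 0) (hpq : p + q = 1) {u : ℕ → ENNReal}
    (hu : ∀ n, u n ≠ ⊤) (hle : ∀ n, u n ≤ c + q * u n) (hsup : e = ⨆ n, u n)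
    (heq : e = c + q * e) : p * e = c := by
  have hq : q ≠ ⊤ := ne_top_of_le_ne_top ENNReal.one_ne_top (hpq ▸ le_add_self)
  refine le_antisymm ?_ ?_
  -- The equation for `e` alone is also solved by `⊤` when `q ≠ 0`. The finite truncated moments `u
  -- n` permit cancelling `q * u n`, which excludes that spurious solution.
  · rw [hsup, ENNReal.mul_iSup]
    refine iSup_le fun n => ?_
    have h : p * u n + q * u n ≤ c + q * u n := by
      rw [← add_mul, hpq, one_mul]; exact hle n
    exact (ENNReal.add_le_add_iff_right (ENNReal.mul_ne_top hq (hu n))).1 h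
  · rcases eq_or_ne e ⊤ with he | he
    · rw [he, ENNReal.mul_top hp0]
      exact le_top
    · have h : c + q * e ≤ p * e + q * e := by
        rw [← add_mul, hpq, one_mul]; exact heq.ge
      exact (ENNReal.add_le_add_iff_right (ENNReal.mul_ne_top hq he)).1 h

variable {a b : ℝ} {ν : Measure ℝ} [IsProbabilityMeasure ν]

lemma ofReal_div_add_ofReal_div (ha : 0 < a) (hb : 0 < b) :
    ENNReal.ofReal (a / (a + b)) + ENNReal.ofReal (b / (a + b)) = 1 := by
  rw [← ENNReal.ofReal_add (by positivity) (by positivity), ← add_div, div_self (by positivity),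
    ENNReal.ofReal_one]

lemma isProbabilityMeasure_cycleLaw (ha : 0 < a) (hb : 0 < b) :
    IsProbabilityMeasure (cycleLaw a b ν) := by
  have := isProbabilityMeasure_sourceLaw ha hb
  have := isProbabilityMeasure_expMeasure (add_pos ha hb)
  infer_instance

lemma cycleLaw_source_ne_zero (ha : 0 < a) (hb : 0 < b) :
    cycleLaw a b ν {p | p.1 = 0} ≠ 0 := by
  have := isProbabilityMeasure_expMeasure (add_pos ha hb)
  have hm : MeasurableSet {p : Fin 2 × ℝ × ℝ | p.1 = 0} :=
    (measurableSet_singleton (0 : Fin 2)).preimage measurable_fst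
  rw [← lintegral_indicator_one hm, lintegral_cycleLaw ha hb (measurable_one.indicator hm)]
  simp
  positivity

lemma ae_cycleLaw_pos {ν : Measure ℝ} [SFinite ν] (ha : 0 < a) (hb : 0 < b) (hν : ∀ᵐ s ∂ν, 0 ≤ s) :
    ∀ᵐ p ∂(cycleLaw a b ν), 0 < p.2.1 ∧ 0 ≤ p.2.2 := by
  have := isProbabilityMeasure_sourceLaw ha hb
  have := isProbabilityMeasure_expMeasure (add_pos ha hb)
  have h1 := Measure.quasiMeasurePreserving_snd (μ := sourceLaw a b)
    (ν := (expMeasure (a + b)).prod ν) |>.ae (Measure.quasiMeasurePreserving_fst.ae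
      (ae_expMeasure_pos (add_pos ha hb)))
  have h2 := Measure.quasiMeasurePreserving_snd (μ := sourceLaw a b)
    (ν := (expMeasure (a + b)).prod ν) |>.ae (Measure.quasiMeasurePreserving_snd.ae hν)
  filter_upwards [h1, h2] with p h1 h2 using ⟨h1, h2⟩

lemma ae_iidLaw_all {X : Type*} [MeasurableSpace X] {π : Measure X} [IsProbabilityMeasure π]
    {s : X → Prop} (h : ∀ᵐ a ∂π, s a) : ∀ᵐ x ∂(iidLaw π), ∀ n, s (x n) :=
  ae_all_iff.2 fun n =>
    (measurePreserving_eval_infinitePi (fun _ : ℕ => π) n).quasiMeasurePreserving.ae h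

lemma ae_deliveryLaw_pos (ha : 0 < a) (hb : 0 < b) (hν : ∀ᵐ s ∂ν, 0 ≤ s) :
    ∀ᵐ w ∂(deliveryLaw (cycleLaw a b ν)), 0 < w.1 ∧ 0 ≤ w.2 := by
  have := isProbabilityMeasure_cycleLaw (ν := ν) ha hb
  refine (ae_map_iff measurable_deliveryCycle.fst.aemeasurable
    ((measurableSet_lt measurable_const measurable_fst).inter
      (measurableSet_le measurable_const measurable_snd))).2 ?_
  filter_upwards [ae_iidLaw_all (ae_cycleLaw_pos ha hb hν)] with x hx
  have h : 0 < (cycleBlock (firstHit x) x).1 :=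
    Finset.sum_pos (f := fun k => (x k).2.1 + (x k).2.2)
      (fun k _ => add_pos_of_pos_of_nonneg (hx k).1 (hx k).2) Finset.nonempty_range_add_one
  exact ⟨h, (hx _).2⟩

lemma lintegral_deliveryLaw_cycleLaw (ha : 0 < a) (hb : 0 < b) {F : ℝ × ℝ → ENNReal}
    (hF : Measurable F) :
    ∫⁻ w, F w ∂(deliveryLaw (cycleLaw a b ν))
      = ENNReal.ofReal (a / (a + b)) *
          ∫⁻ p, F (p.1 + p.2, p.2) ∂((expMeasure (a + b)).prod ν)
        + ENNReal.ofReal (b / (a + b)) * ∫⁻ p, ∫⁻ w, F (p.1 + p.2 + w.1, w.2)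
          ∂(deliveryLaw (cycleLaw a b ν)) ∂((expMeasure (a + b)).prod ν) := by
  have := isProbabilityMeasure_cycleLaw (ν := ν) ha hb
  rw [lintegral_deliveryLaw_rec (cycleLaw_source_ne_zero ha hb) hF, lintegral_cycleLaw ha hb]
  · simp
  · refine Measurable.ite ((measurableSet_singleton (0 : Fin 2)).preimage measurable_fst)
      (by fun_prop) ?_
    exact Measurable.lintegral_prod_right'
      (f := fun q : (Fin 2 × ℝ × ℝ) × ℝ × ℝ => F (q.1.2.1 + q.1.2.2 + q.2.1, q.2.2)) (by fun_prop)

/-- The service time of a delivered packet has the service time distribution. -/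
lemma map_snd_deliveryLaw (ha : 0 < a) (hb : 0 < b) :
    (deliveryLaw (cycleLaw a b ν)).map Prod.snd = ν := by
  have := isProbabilityMeasure_expMeasure (add_pos ha hb)
  have := isProbabilityMeasure_cycleLaw (ν := ν) ha hb
  ext s hs
  have hm := measurable_one.indicator hs (f := (1 : ℝ → ENNReal))
  have h := lintegral_deliveryLaw_cycleLaw (ν := ν) ha hb (hm.comp measurable_snd)
  simp only [Function.comp_apply] at h
  have e1 : ∫⁻ w : ℝ × ℝ, s.indicator (1 : ℝ → ENNReal) w.2 ∂(deliveryLaw (cycleLaw a b ν))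
      = (deliveryLaw (cycleLaw a b ν)).map Prod.snd s := by
    rw [← lintegral_indicator_one hs, lintegral_map hm measurable_snd]
  have e2 : ∫⁻ p : ℝ × ℝ, s.indicator (1 : ℝ → ENNReal) p.2 ∂((expMeasure (a + b)).prod ν)
      = ν s := by
    rw [lintegral_prod (fun p : ℝ × ℝ => s.indicator (1 : ℝ → ENNReal) p.2)
      (hm.comp measurable_snd).aemeasurable]
    simp [lintegral_indicator_one hs]
  rw [e1, e2, lintegral_const, measure_univ, mul_one] at h
  have hfin := measure_ne_top ((deliveryLaw (cycleLaw a b ν)).map Prod.snd) s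
  have hpq := ofReal_div_add_ofReal_div ha hb
  have hp : ENNReal.ofReal (a / (a + b)) ≠ 0 := by
    rw [ENNReal.ofReal_ne_zero_iff]; positivity
  -- The unknown is a probability, hence finite, and a constant sequence serves as its truncation.
  have h2 := ENNReal.mul_eq_of_truncated hp hpq (u := fun _ => _) (fun _ => hfin) (fun _ => h.le)
    (by simp) h
  exact (ENNReal.mul_right_inj hp ENNReal.ofReal_ne_top).1 h2

lemma lintegral_ofReal_add_expMeasure (hb : 0 < b) (hν : ∀ᵐ s ∂ν, 0 ≤ s) :
    ∫⁻ p, ENNReal.ofReal (p.1 + p.2) ∂((expMeasure b).prod ν)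
      = ENNReal.ofReal (1 / b) + ∫⁻ s, ENNReal.ofReal s ∂ν := by
  have := isProbabilityMeasure_expMeasure hb
  have h1 := lintegral_expMeasure_gamma hb 1
  simp only [pow_one, Nat.factorial_one, Nat.cast_one] at h1
  rw [lintegral_prod _ (by fun_prop), ← h1]
  calc ∫⁻ g, ∫⁻ s, ENNReal.ofReal (g + s) ∂ν ∂(expMeasure b)
      = ∫⁻ g, (ENNReal.ofReal g + ∫⁻ s, ENNReal.ofReal s ∂ν) ∂(expMeasure b) := by
        refine lintegral_congr_ae ?_
        filter_upwards [ae_expMeasure_pos hb] with g hg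
        rw [lintegral_congr_ae (g := fun s => ENNReal.ofReal g + ENNReal.ofReal s)
          (by filter_upwards [hν] with s hs using ENNReal.ofReal_add hg.le hs),
          lintegral_add_left measurable_const]
        simp
    _ = _ := by
        rw [lintegral_add_left (by fun_prop)]
        simp

lemma lintegral_ofReal_add_sq_expMeasure (hb : 0 < b) (hν : ∀ᵐ s ∂ν, 0 ≤ s) :
    ∫⁻ p, ENNReal.ofReal (p.1 + p.2) ^ 2 ∂((expMeasure b).prod ν)
      = ENNReal.ofReal (2 / b ^ 2) + 2 * ENNReal.ofReal (1 / b) * ∫⁻ s, ENNReal.ofReal s ∂ν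
        + ∫⁻ s, ENNReal.ofReal (s ^ 2) ∂ν := by
  have := isProbabilityMeasure_expMeasure hb
  have h1 := lintegral_expMeasure_gamma hb 1
  have h2 := lintegral_expMeasure_gamma hb 2
  simp only [pow_one, Nat.factorial_one, Nat.cast_one] at h1
  simp only [Nat.factorial_two, Nat.cast_ofNat] at h2
  rw [lintegral_prod _ (by fun_prop), ← h1, ← h2]
  calc ∫⁻ g, ∫⁻ s, ENNReal.ofReal (g + s) ^ 2 ∂ν ∂(expMeasure b)
      = ∫⁻ g, (ENNReal.ofReal (g ^ 2) + 2 * ENNReal.ofReal g * ∫⁻ s, ENNReal.ofReal s ∂ν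
          + ∫⁻ s, ENNReal.ofReal (s ^ 2) ∂ν) ∂(expMeasure b) := by
        refine lintegral_congr_ae ?_
        filter_upwards [ae_expMeasure_pos hb] with g hg
        rw [lintegral_congr_ae (g := fun s => ENNReal.ofReal (g ^ 2)
            + 2 * ENNReal.ofReal g * ENNReal.ofReal s + ENNReal.ofReal (s ^ 2)),
          lintegral_add_left (by fun_prop), lintegral_add_left (by fun_prop),
          lintegral_const_mul _ (by fun_prop)]
        · simp
        · filter_upwards [hν] with s hs
          rw [ENNReal.ofReal_add hg.le hs, ENNReal.ofReal_pow hg.le, ENNReal.ofReal_pow hs]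
          ring
    _ = _ := by
        rw [lintegral_add_left (by fun_prop), lintegral_add_left (by fun_prop),
          lintegral_mul_const _ (by fun_prop), lintegral_const_mul _ (by fun_prop)]
        simp

lemma lintegral_ofReal_pow_eq_iSup {X : Type*} [MeasurableSpace X] {π : Measure X} {f : X → ℝ}
    (hf : Measurable f) (k : ℕ) :
    ∫⁻ x, ENNReal.ofReal (f x) ^ k ∂π = ⨆ n : ℕ, ∫⁻ x, ENNReal.ofReal (min (f x) n) ^ k ∂π := by
  rw [← lintegral_iSup (fun n => by fun_prop)]
  · refine lintegral_congr fun x => le_antisymm ?_ ?_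
    · obtain ⟨n, hn⟩ := exists_nat_ge (f x)
      exact (le_iSup (fun n : ℕ => ENNReal.ofReal (min (f x) n) ^ k) n).trans'
        (by rw [min_eq_left hn])
    · exact iSup_le fun n => pow_le_pow_left' (ENNReal.ofReal_le_ofReal (min_le_left _ _)) k
  · intro m n hmn x
    exact pow_le_pow_left'
      (ENNReal.ofReal_le_ofReal (min_le_min_left _ (by exact_mod_cast hmn))) k

lemma lintegral_ofReal_min_pow_ne_top {X : Type*} [MeasurableSpace X] {π : Measure X}
    [IsFiniteMeasure π] (f : X → ℝ) (n k : ℕ) :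
    ∫⁻ x, ENNReal.ofReal (min (f x) n) ^ k ∂π ≠ ⊤ := by
  refine ne_top_of_le_ne_top (b := ∫⁻ _, ENNReal.ofReal n ^ k ∂π) ?_
    (lintegral_mono fun w => pow_le_pow_left' (ENNReal.ofReal_le_ofReal (min_le_right _ _)) k)
  rw [lintegral_const]
  exact ENNReal.mul_ne_top (by simp) (measure_ne_top _ _)

lemma ae_prod_expMeasure_nonneg {ν : Measure ℝ} [SFinite ν] (hb : 0 < b) (hν : ∀ᵐ s ∂ν, 0 ≤ s) :
    ∀ᵐ p : ℝ × ℝ ∂((expMeasure b).prod ν), 0 ≤ p.1 + p.2 := by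
  have h1 := Measure.quasiMeasurePreserving_fst (μ := expMeasure b) (ν := ν) |>.ae
    (ae_expMeasure_pos hb)
  have h2 := Measure.quasiMeasurePreserving_snd (μ := expMeasure b) (ν := ν) |>.ae hν
  filter_upwards [h1, h2] with p h1 h2 using by linarith

/-- Truncating only the remaining part of a cycle bounds the truncated total; this turns the
first-step recursion into the inequality required of truncated moments. -/
lemma ofReal_min_add_le (x y : ℝ) {n : ℝ} (hx : 0 ≤ x) :
    ENNReal.ofReal (min (x + y) n) ≤ ENNReal.ofReal x + ENNReal.ofReal (min y n) := by
  refine le_trans (ENNReal.ofReal_le_ofReal ?_) ENNReal.ofReal_add_le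
  rcases min_cases y n with h | h <;> rw [h.1]
  · exact min_le_left _ _
  · exact (min_le_right _ _).trans (by linarith)

/-- Mean of the length of a delivery cycle. -/
lemma mul_lintegral_deliveryLaw (ha : 0 < a) (hb : 0 < b) (hν : ∀ᵐ s ∂ν, 0 ≤ s) :
    ENNReal.ofReal (a / (a + b)) * ∫⁻ w, ENNReal.ofReal w.1 ∂(deliveryLaw (cycleLaw a b ν))
      = ∫⁻ p, ENNReal.ofReal (p.1 + p.2) ∂((expMeasure (a + b)).prod ν) := by
  have := isProbabilityMeasure_expMeasure (add_pos ha hb)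
  have := isProbabilityMeasure_cycleLaw (ν := ν) ha hb
  have hpq := ofReal_div_add_ofReal_div ha hb
  have hp0 : ENNReal.ofReal (a / (a + b)) ≠ 0 := by
    rw [ENNReal.ofReal_ne_zero_iff]; positivity
  have hpos := ae_deliveryLaw_pos ha hb hν
  have hpos' := ae_prod_expMeasure_nonneg (add_pos ha hb) hν
  have hrec := fun F => @lintegral_deliveryLaw_cycleLaw a b ν _ ha hb F
  set κ := deliveryLaw (cycleLaw a b ν)
  set η := (expMeasure (a + b)).prod ν
  -- The right side of the recursion with the moment of the fresh cycle replaced by `u`; it serves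
  -- both the truncated inequality and the exact equation.
  have hexp : ∀ u : ENNReal,
      ENNReal.ofReal (a / (a + b)) * ∫⁻ p, ENNReal.ofReal (p.1 + p.2) ∂η
        + ENNReal.ofReal (b / (a + b)) * ∫⁻ p, (ENNReal.ofReal (p.1 + p.2) + u) ∂η
      = (∫⁻ p, ENNReal.ofReal (p.1 + p.2) ∂η) + ENNReal.ofReal (b / (a + b)) * u := by
    intro u
    rw [lintegral_add_right _ measurable_const, lintegral_const, measure_univ, mul_one, mul_add,
      ← add_assoc, ← add_mul, hpq, one_mul]
  have hsup := lintegral_ofReal_pow_eq_iSup (π := κ) measurable_fst 1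
  have hfin := lintegral_ofReal_min_pow_ne_top (π := κ) Prod.fst (k := 1)
  simp only [pow_one] at hsup hfin
  refine ENNReal.mul_eq_of_truncated hp0 hpq hfin (fun n => ?_) hsup ?_
  · rw [← hexp]
    refine (hrec (fun w => ENNReal.ofReal (min w.1 n)) (by fun_prop)).le.trans ?_
    refine add_le_add (mul_le_mul_right (lintegral_mono fun p =>
      ENNReal.ofReal_le_ofReal (min_le_left _ _)) _) (mul_le_mul_right (lintegral_mono_ae ?_) _)
    filter_upwards [hpos'] with p hp
    refine (lintegral_mono fun w => ofReal_min_add_le _ _ hp).trans ?_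
    rw [lintegral_add_left measurable_const]
    simp
  · rw [← hexp]
    refine (hrec (fun w => ENNReal.ofReal w.1) (by fun_prop)).trans ?_
    congr 2
    refine lintegral_congr_ae ?_
    filter_upwards [hpos'] with p hp
    rw [lintegral_congr_ae (g := fun w => ENNReal.ofReal (p.1 + p.2) + ENNReal.ofReal w.1)
      (by filter_upwards [hpos] with w hw using ENNReal.ofReal_add hp hw.1.le),
      lintegral_add_left measurable_const]
    simp

/-- Second moment of the length of a delivery cycle. -/
lemma mul_lintegral_sq_deliveryLaw (ha : 0 < a) (hb : 0 < b) (hν : ∀ᵐ s ∂ν, 0 ≤ s) :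
    ENNReal.ofReal (a / (a + b)) * ∫⁻ w, ENNReal.ofReal w.1 ^ 2 ∂(deliveryLaw (cycleLaw a b ν))
      = ∫⁻ p, ENNReal.ofReal (p.1 + p.2) ^ 2 ∂((expMeasure (a + b)).prod ν)
        + ENNReal.ofReal (b / (a + b)) *
          (2 * (∫⁻ p, ENNReal.ofReal (p.1 + p.2) ∂((expMeasure (a + b)).prod ν)) *
            ∫⁻ w, ENNReal.ofReal w.1 ∂(deliveryLaw (cycleLaw a b ν))) := by
  have := isProbabilityMeasure_expMeasure (add_pos ha hb)
  have := isProbabilityMeasure_cycleLaw (ν := ν) ha hb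
  have hpq := ofReal_div_add_ofReal_div ha hb
  have hp0 : ENNReal.ofReal (a / (a + b)) ≠ 0 := by
    rw [ENNReal.ofReal_ne_zero_iff]; positivity
  have hpos := ae_deliveryLaw_pos ha hb hν
  have hpos' := ae_prod_expMeasure_nonneg (add_pos ha hb) hν
  have hrec := fun F => @lintegral_deliveryLaw_cycleLaw a b ν _ ha hb F
  set κ := deliveryLaw (cycleLaw a b ν)
  set η := (expMeasure (a + b)).prod ν
  have hexp : ∀ m u : ENNReal,
      ENNReal.ofReal (a / (a + b)) * ∫⁻ p, ENNReal.ofReal (p.1 + p.2) ^ 2 ∂η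
        + ENNReal.ofReal (b / (a + b)) * ∫⁻ p, (ENNReal.ofReal (p.1 + p.2) ^ 2
          + 2 * ENNReal.ofReal (p.1 + p.2) * m + u) ∂η
      = ((∫⁻ p, ENNReal.ofReal (p.1 + p.2) ^ 2 ∂η) + ENNReal.ofReal (b / (a + b)) *
          (2 * (∫⁻ p, ENNReal.ofReal (p.1 + p.2) ∂η) * m)) + ENNReal.ofReal (b / (a + b)) * u := by
    intro m u
    rw [lintegral_add_right _ measurable_const, lintegral_const, measure_univ, mul_one,
      lintegral_add_left (by fun_prop), lintegral_mul_const _ (by fun_prop),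
      lintegral_const_mul _ (by fun_prop), mul_add, mul_add, ← add_assoc, ← add_assoc, ← add_mul,
      hpq, one_mul]
  have hsq : ∀ (p : ℝ × ℝ) (f : ℝ × ℝ → ENNReal), Measurable f →
      ∫⁻ w, (ENNReal.ofReal (p.1 + p.2) + f w) ^ 2 ∂κ = ENNReal.ofReal (p.1 + p.2) ^ 2
        + 2 * ENNReal.ofReal (p.1 + p.2) * (∫⁻ w, f w ∂κ) + ∫⁻ w, f w ^ 2 ∂κ := by
    intro p f hf
    simp_rw [add_sq]
    rw [lintegral_add_left (by fun_prop), lintegral_add_left (by fun_prop),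
      lintegral_const_mul _ hf, lintegral_const, measure_univ, mul_one]
  refine ENNReal.mul_eq_of_truncated hp0 hpq
    (lintegral_ofReal_min_pow_ne_top (π := κ) Prod.fst (k := 2)) (fun n => ?_)
    (lintegral_ofReal_pow_eq_iSup (π := κ) measurable_fst 2) ?_
  · rw [← hexp]
    refine (hrec (fun w => ENNReal.ofReal (min w.1 n) ^ 2) (by fun_prop)).le.trans ?_
    refine add_le_add (mul_le_mul_right (lintegral_mono fun p => pow_le_pow_left'
      (ENNReal.ofReal_le_ofReal (min_le_left _ _)) 2) _) (mul_le_mul_right (lintegral_mono_ae ?_) _)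
    filter_upwards [hpos'] with p hp
    refine (lintegral_mono fun w => pow_le_pow_left' (ofReal_min_add_le _ _ hp) 2).trans ?_
    rw [hsq p (fun w => ENNReal.ofReal (min w.1 n)) (by fun_prop)]
    gcongr
    -- Only the cross term needs this: there the truncated mean is replaced by the full one.
    exact min_le_left _ _
  · rw [← hexp]
    refine (hrec (fun w => ENNReal.ofReal w.1 ^ 2) (by fun_prop)).trans ?_
    congr 2
    refine lintegral_congr_ae ?_
    filter_upwards [hpos'] with p hp
    rw [← hsq p (fun w => ENNReal.ofReal w.1) (by fun_prop)]
    refine lintegral_congr_ae ?_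
    filter_upwards [hpos] with w hw
    rw [ENNReal.ofReal_add hp hw.1.le]

end Moments

/-! ### Pathwise identification of the system with iterated cycles -/

namespace StatusUpdateSystem

variable {Ω : Type*} (M : StatusUpdateSystem Ω)

/-- Gaps and service times of the packets of source `c`. -/
def pointSeq (c : Fin 2) (ω : Ω) (n : ℕ) : ℝ × ℝ := (M.gap (c, n) ω, M.service (c, n) ω)

/-- The two arrival processes seen from time `d`. -/
def view (d : ℝ) (ω : Ω) : (ℕ → ℝ × ℝ) × (ℕ → ℝ × ℝ) :=
  (residualSeq d (M.pointSeq 0 ω), residualSeq d (M.pointSeq 1 ω))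

/-- Source, idle time and service time of the `k`-th cycle of the server. -/
def cycleData (ω : Ω) (k : ℕ) : Fin 2 × ℝ × ℝ :=
  ((M.served k ω).1, M.genTime (M.served k ω) ω - M.freeTime k ω, M.service (M.served k ω) ω)

/-- Lengths and final service times of the delivery cycles of source `0`. -/
def deliverySeq (ω : Ω) : ℕ → ℝ × ℝ :=
  unfoldSeq deliveryCycle (unfoldSeq serviceCycle (M.view (M.busyUntil ω) ω))

/-- Both sources generate packets after any given time, and no service time is negative. -/
structure Proper (ω : Ω) : Prop where
  exists_lt : ∀ c d, ∃ n, d < M.genTime (c, n) ω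
  service_nonneg : ∀ p, 0 ≤ M.service p ω

/-- Moreover, infinitely many packets of source `0` are served. -/
structure Regular (ω : Ω) : Prop extends M.Proper ω where
  hits : {k | (M.served k ω).1 = 0}.Infinite

variable {M} {ω : Ω}

lemma genTime_eq_pointTime (c : Fin 2) (n : ℕ) (ω : Ω) :
    M.genTime (c, n) ω = pointTime (M.pointSeq c ω) n := rfl

/-- Subtracting the free time from both candidate arrival times does not change which of them is
smaller. -/
lemma cycleHead_view (k : ℕ) : cycleHead (M.view (M.freeTime k ω) ω) = M.cycleData ω k := by
  have h0 : M.nextOfSource 0 (M.freeTime k ω) ω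
    = (0, crossing (M.freeTime k ω) (M.pointSeq 0 ω)) := rfl
  have h1 : M.nextOfSource 1 (M.freeTime k ω) ω
    = (1, crossing (M.freeTime k ω) (M.pointSeq 1 ω)) := rfl
  simp only [cycleHead, view, cycleData, served, nextPacket, h0, h1, residualSeq, if_true, add_zero,
    genTime_eq_pointTime, sub_le_sub_iff_right]
  split_ifs <;> rfl

lemma freeTime_succ (k : ℕ) : M.freeTime (k + 1) ω
    = M.freeTime k ω + ((M.cycleData ω k).2.1 + (M.cycleData ω k).2.2) := by
  simp only [freeTime, cycleData, served]
  ring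

namespace Proper

lemma freeTime_lt_genTime (h : M.Proper ω) (k : ℕ) :
    M.freeTime k ω < M.genTime (M.served k ω) ω := by
  have h' : ∀ c, M.freeTime k ω < M.genTime (M.nextOfSource c (M.freeTime k ω) ω) ω := fun c =>
    Nat.sInf_mem (h.exists_lt c (M.freeTime k ω))
  rw [served, nextPacket]
  split_ifs
  exacts [h' 0, h' 1]

lemma cycleData_pos (h : M.Proper ω) (k : ℕ) :
    0 < (M.cycleData ω k).2.1 ∧ 0 ≤ (M.cycleData ω k).2.2 :=
  ⟨sub_pos.2 (h.freeTime_lt_genTime k), h.service_nonneg _⟩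

lemma view_succ (h : M.Proper ω) (k : ℕ) :
    M.view (M.freeTime (k + 1) ω) ω = (serviceCycle (M.view (M.freeTime k ω) ω)).2 := by
  have h2 := h.cycleData_pos k
  rw [serviceCycle, cycleHead_view, freeTime_succ, view, view]
  congr 1
  · exact (residualSeq_residualSeq (add_nonneg h2.1.le h2.2) (h.exists_lt 0 _)).symm
  · exact (residualSeq_residualSeq (add_nonneg h2.1.le h2.2) (h.exists_lt 1 _)).symm

/-- The link between the recursive policy and the abstract iteration, which makes `map_unfoldSeq`
applicable. -/
lemma cycleData_eq (h : M.Proper ω) :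
    M.cycleData ω = unfoldSeq serviceCycle (M.view (M.busyUntil ω) ω) := by
  have hit : ∀ k, M.view (M.freeTime k ω) ω
      = (fun z => (serviceCycle z).2)^[k] (M.view (M.busyUntil ω) ω) := by
    intro k
    induction k with
    | zero => rfl
    | succ k ih => rw [h.view_succ, Function.iterate_succ_apply', ih]
  ext1 k
  rw [unfoldSeq, ← hit, serviceCycle, cycleHead_view]

end Proper

namespace Regular

lemma position_succ (h : M.Regular ω) (i : ℕ) : M.position 0 (i + 1) ω
    = M.position 0 i ω + 1 + firstHit fun j => M.cycleData ω (M.position 0 i ω + 1 + j) := by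
  set p : ℕ → Prop := fun k => (M.served k ω).1 = 0
  have hinf : (Set.ofPred p).Infinite := h.hits
  have hlt : M.position 0 i ω < M.position 0 (i + 1) ω :=
    Nat.nth_strictMono hinf (Nat.lt_succ_self i)
  obtain ⟨m, hm⟩ := Nat.exists_eq_add_of_le (Nat.succ_le_of_lt hlt)
  have hpm : (M.cycleData ω (M.position 0 i ω + 1 + m)).1 = 0 := by
    have : p (M.position 0 (i + 1) ω) := Nat.nth_mem_of_infinite hinf _
    rw [hm] at this
    exact this
  refine le_antisymm ?_ ?_
  · have hq : (M.cycleData ω (M.position 0 i ω + 1 +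
        firstHit fun j => M.cycleData ω (M.position 0 i ω + 1 + j))).1 = 0 :=
      (hitsAt_firstHit (x := fun j => M.cycleData ω (M.position 0 i ω + 1 + j)) ⟨m, hpm⟩).1
    conv_lhs => rw [position, Nat.nth_eq_sInf]
    refine Nat.sInf_le ⟨hq, fun k hk => ?_⟩
    have : Nat.nth p k ≤ M.position 0 i ω :=
      (Nat.nth_strictMono hinf).monotone (Nat.lt_succ_iff.1 hk)
    exact this.trans_lt (by omega)
  · rw [hm]
    exact Nat.add_le_add_left (Nat.sInf_le hpm) _

lemma position_zero : M.position 0 0 ω = firstHit (M.cycleData ω) := Nat.nth_zero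

/-- After `i + 1` delivery cycles, what remains starts just behind the service cycle of delivery
`i`, whence the shift by `position + 1`. -/
lemma iterate_deliveryCycle (h : M.Regular ω) (i : ℕ) :
    (fun x => (deliveryCycle x).2)^[i + 1] (M.cycleData ω)
      = fun j => M.cycleData ω (M.position 0 i ω + 1 + j) := by
  induction i with
  | zero => rw [position_zero]; rfl
  | succ i ih =>
    rw [Function.iterate_succ_apply', ih, h.position_succ i]
    simp only [deliveryCycle, add_assoc]

lemma freeTime_add (n m : ℕ) : M.freeTime (n + m) ω = M.freeTime n ω
    + ∑ k ∈ Finset.range m, ((M.cycleData ω (n + k)).2.1 + (M.cycleData ω (n + k)).2.2) := by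
  induction m with
  | zero => simp
  | succ m ih => rw [← add_assoc, freeTime_succ, ih, Finset.sum_range_succ, add_assoc]

lemma deliveryTime_zero (h : M.Regular ω) :
    M.deliveryTime 0 0 ω = M.busyUntil ω + (M.deliverySeq ω 0).1 := by
  rw [deliveryTime, deliverySeq, ← h.cycleData_eq, position_zero]
  have := freeTime_add (M := M) (ω := ω) 0 (firstHit (M.cycleData ω) + 1)
  simp only [zero_add] at this
  rw [this]
  rfl

lemma deliveryTime_succ (h : M.Regular ω) (i : ℕ) :
    M.deliveryTime 0 (i + 1) ω = M.deliveryTime 0 i ω + (M.deliverySeq ω (i + 1)).1 := by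
  rw [deliveryTime, deliverySeq, ← h.cycleData_eq, h.position_succ, unfoldSeq,
    h.iterate_deliveryCycle, add_assoc, freeTime_add]
  rfl

lemma systemTime_eq (h : M.Regular ω) (i : ℕ) :
    M.systemTime 0 i ω = (M.deliverySeq ω i).2 := by
  have h1 : M.systemTime 0 i ω = (M.cycleData ω (M.position 0 i ω)).2.2 := by
    simp only [systemTime, deliveryTime, deliveredGen, freeTime, cycleData, served]
    ring
  rw [h1, deliverySeq, ← h.cycleData_eq, unfoldSeq]
  cases i with
  | zero => rw [position_zero]; rfl
  | succ i => rw [h.iterate_deliveryCycle, h.position_succ]; rfl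

end Regular

end StatusUpdateSystem

/-! ### Laws of the cycles under the M/G/1/1 assumptions -/

lemma iidLaw_map_shift {X : Type*} [MeasurableSpace X] (π : Measure X) [IsProbabilityMeasure π]
    (m : ℕ) : MeasurePreserving (fun (x : ℕ → X) n => x (m + n)) (iidLaw π) (iidLaw π) :=
  ⟨by fun_prop, Measure.map_infinitePi_infinitePi_of_inj (P := fun _ : ℕ => π)
    (f := fun n => m + n) (add_right_injective m)⟩

namespace StatusUpdateSystem.IsMG11

variable {Ω : Type*} [MeasurableSpace Ω] {M : StatusUpdateSystem Ω} {P : Measure Ω}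
  {lam : Fin 2 → ℝ} {ν : Measure ℝ}

lemma measurable_gap (hM : M.IsMG11 P lam ν) (p : Fin 2 × ℕ) : Measurable (M.gap p) :=
  hM.measurable_primitives (Sum.inl p)

lemma measurable_service (hM : M.IsMG11 P lam ν) (p : Fin 2 × ℕ) : Measurable (M.service p) :=
  hM.measurable_primitives (Sum.inr p)

lemma measurable_busyUntil (hM : M.IsMG11 P lam ν) : Measurable M.busyUntil :=
  measurable_fst.comp hM.measurable_initState

lemma measurable_pointSeq (hM : M.IsMG11 P lam ν) (c : Fin 2) : Measurable (M.pointSeq c) :=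
  measurable_pi_iff.2 fun n => (hM.measurable_gap (c, n)).prodMk (hM.measurable_service (c, n))

lemma measurable_view (hM : M.IsMG11 P lam ν) :
    Measurable fun ω => M.view (M.busyUntil ω) ω := by
  have h : ∀ c, Measurable fun ω => residualSeq (M.busyUntil ω) (M.pointSeq c ω) := fun c =>
    measurable_residualSeq.comp (f := fun ω => (M.busyUntil ω, M.pointSeq c ω))
      (hM.measurable_busyUntil.prodMk (hM.measurable_pointSeq c))
  exact (h 0).prodMk (h 1)

lemma measurable_cycles (hM : M.IsMG11 P lam ν) :
    Measurable fun ω => unfoldSeq serviceCycle (M.view (M.busyUntil ω) ω) :=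
  (measurable_unfoldSeq measurable_serviceCycle).comp hM.measurable_view

lemma measurable_deliverySeq (hM : M.IsMG11 P lam ν) : Measurable M.deliverySeq :=
  (measurable_unfoldSeq measurable_deliveryCycle).comp hM.measurable_cycles

variable [IsProbabilityMeasure ν]

/-- The packets of the two sources form independent marked Poisson processes. -/
lemma map_pointSeq (hM : M.IsMG11 P lam ν) (hlam : ∀ c, 0 < lam c) :
    P.map (fun ω => (M.pointSeq 0 ω, M.pointSeq 1 ω))
      = (poissonLaw (lam 0) ν).prod (poissonLaw (lam 1) ν) := by
  have hexp : ∀ c, IsProbabilityMeasure (expMeasure (lam c)) := fun c =>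
    isProbabilityMeasure_expMeasure (hlam c)
  -- Reindexing by packet and a Boolean (gap or service) lets the product measure be curried, first
  -- into pairs per packet and then into one sequence per source.
  let e : (Fin 2 × ℕ) × Bool → (Fin 2 × ℕ) ⊕ (Fin 2 × ℕ) := fun q =>
    bif q.2 then Sum.inr q.1 else Sum.inl q.1
  have he : Function.Injective e := by
    rintro ⟨p, _ | _⟩ ⟨p', _ | _⟩ h <;> simp_all [e]
  let law : (Fin 2 × ℕ) × Bool → Measure ℝ := fun q => bif q.2 then ν else expMeasure (lam q.1.1)
  have hlaw : ∀ q, IsProbabilityMeasure (law q) := by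
    rintro ⟨p, _ | _⟩ <;> simp only [law, cond_true, cond_false] <;> infer_instance
  have h1 : P.map (fun ω q => M.primitives (e q) ω) = Measure.infinitePi law := by
    rw [(hM.indep_primitives.precomp he).map_fun_eq_infinitePi_map
      fun q => hM.measurable_primitives (e q)]
    congr 1
    ext1 q
    rcases q with ⟨p, _ | _⟩
    · exact hM.gap_law p
    · exact hM.service_law p
  have h2 : P.map (fun ω p b => M.primitives (e (p, b)) ω)
      = Measure.infinitePi fun p => Measure.infinitePi fun b => law (p, b) := by
    rw [← Measure.infinitePi_map_curry, ← h1, Measure.map_map (by fun_prop)]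
    · rfl
    · exact measurable_pi_iff.2 fun q => hM.measurable_primitives (e q)
  have h3 : P.map (fun ω (p : Fin 2 × ℕ) => (M.gap p ω, M.service p ω))
      = Measure.infinitePi fun p : Fin 2 × ℕ => (expMeasure (lam p.1)).prod ν := by
    have hf : ∀ p : Fin 2 × ℕ, (Measure.infinitePi fun b => law (p, b)).map
        (fun y : Bool → ℝ => (y false, y true)) = (expMeasure (lam p.1)).prod ν := fun p =>
      Measure.infinitePi_map_eval_prod (P := fun b => law (p, b)) (by simp)
    have := Measure.infinitePi_map_pi (fun p => Measure.infinitePi fun b => law (p, b))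
      (f := fun (_ : Fin 2 × ℕ) (y : Bool → ℝ) => (y false, y true)) (fun _ => by fun_prop)
    simp_rw [hf] at this
    rw [← this, ← h2, Measure.map_map (by fun_prop)]
    · rfl
    · exact measurable_pi_iff.2 fun p => measurable_pi_iff.2 fun b =>
        hM.measurable_primitives (e (p, b))
  have h4 : P.map (fun ω (c : Fin 2) (n : ℕ) => (M.gap (c, n) ω, M.service (c, n) ω))
      = Measure.infinitePi fun c => poissonLaw (lam c) ν := by
    have := Measure.infinitePi_map_curry
      (fun (c : Fin 2) (_ : ℕ) => (expMeasure (lam c)).prod ν)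
    rw [← this, ← h3, Measure.map_map (by fun_prop)]
    · rfl
    · exact measurable_pi_iff.2 fun p => (hM.measurable_gap p).prodMk (hM.measurable_service p)
  have h5 := Measure.infinitePi_map_eval_prod (P := fun c => poissonLaw (lam c) ν)
    (i := 0) (j := 1) (by simp)
  rw [← h5, ← h4, Measure.map_map (by fun_prop)]
  · rfl
  · exact measurable_pi_iff.2 fun c => hM.measurable_pointSeq c

variable [IsProbabilityMeasure P]

/-- The initial busy period is random but nonnegative and independent of the arrivals. Conditionally
on its length, restarting the processes at a fixed time applies. -/
lemma map_view (hM : M.IsMG11 P lam ν) (hlam : ∀ c, 0 < lam c) :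
    P.map (fun ω => M.view (M.busyUntil ω) ω)
      = (poissonLaw (lam 0) ν).prod (poissonLaw (lam 1) ν) := by
  have hexp : ∀ c, IsProbabilityMeasure (expMeasure (lam c)) := fun c =>
    isProbabilityMeasure_expMeasure (hlam c)
  have hpts := (hM.measurable_pointSeq 0).prodMk (hM.measurable_pointSeq 1)
  have hind : IndepFun M.busyUntil (fun ω => (M.pointSeq 0 ω, M.pointSeq 1 ω)) P := by
    have := hM.indep_initState.comp measurable_fst (ψ := fun y : (Fin 2 × ℕ) ⊕ (Fin 2 × ℕ) → ℝ =>
      ((fun n => (y (Sum.inl (0, n)), y (Sum.inr (0, n))),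
        fun n => (y (Sum.inl (1, n)), y (Sum.inr (1, n)))) : (ℕ → ℝ × ℝ) × (ℕ → ℝ × ℝ)))
      (by fun_prop)
    exact this
  have hjoint := hind.map_prod_eq_prod_map_map hM.measurable_busyUntil.aemeasurable
    hpts.aemeasurable
  rw [hM.map_pointSeq hlam] at hjoint
  let V : ℝ × (ℕ → ℝ × ℝ) × (ℕ → ℝ × ℝ) → (ℕ → ℝ × ℝ) × (ℕ → ℝ × ℝ) := fun q =>
    (residualSeq q.1 q.2.1, residualSeq q.1 q.2.2)
  have hV : Measurable V := by
    refine .prodMk ?_ ?_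
    · exact measurable_residualSeq.comp (f := fun q : ℝ × (ℕ → ℝ × ℝ) × (ℕ → ℝ × ℝ) =>
        (q.1, q.2.1)) (by fun_prop)
    · exact measurable_residualSeq.comp (f := fun q : ℝ × (ℕ → ℝ × ℝ) × (ℕ → ℝ × ℝ) =>
        (q.1, q.2.2)) (by fun_prop)
  have hcomp : P.map (fun ω => M.view (M.busyUntil ω) ω) = ((P.map M.busyUntil).prod
      ((poissonLaw (lam 0) ν).prod (poissonLaw (lam 1) ν))).map V := by
    rw [← hjoint, Measure.map_map hV (hM.measurable_busyUntil.prodMk hpts)]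
    rfl
  have hprob : IsProbabilityMeasure (P.map M.busyUntil) :=
    Measure.isProbabilityMeasure_map hM.measurable_busyUntil.aemeasurable
  have hnonneg : ∀ᵐ d ∂(P.map M.busyUntil), 0 ≤ d :=
    (ae_map_iff hM.measurable_busyUntil.aemeasurable measurableSet_Ici).2
      (Eventually.of_forall hM.busyUntil_nonneg)
  refine Measure.ext_of_lintegral _ fun f hf => ?_
  rw [hcomp, lintegral_map hf hV,
    lintegral_prod (fun q => f (V q)) (hf.comp hV).aemeasurable]
  have key : ∀ᵐ d ∂(P.map M.busyUntil),
      ∫⁻ z, f (V (d, z)) ∂((poissonLaw (lam 0) ν).prod (poissonLaw (lam 1) ν))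
      = ∫⁻ z, f z ∂((poissonLaw (lam 0) ν).prod (poissonLaw (lam 1) ν)) := by
    filter_upwards [hnonneg] with d hd
    rw [lintegral_prod (fun z => f (V (d, z)))
      (hf.comp (hV.comp measurable_prodMk_left)).aemeasurable, lintegral_prod _ hf.aemeasurable]
    rw [← lintegral_residualSeq (hlam 0) hd hf.lintegral_prod_right']
    refine lintegral_congr fun x => ?_
    exact lintegral_residualSeq (hlam 1) hd (f := fun y => f (residualSeq d x, y)) (by fun_prop)
  rw [lintegral_congr_ae key]
  simp

lemma map_cycles (hM : M.IsMG11 P lam ν) (hlam : ∀ c, 0 < lam c) (hν : ∀ᵐ x ∂ν, 0 ≤ x) :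
    P.map (fun ω => unfoldSeq serviceCycle (M.view (M.busyUntil ω) ω))
      = iidLaw (cycleLaw (lam 0) (lam 1) ν) := by
  have hexp : ∀ c, IsProbabilityMeasure (expMeasure (lam c)) := fun c =>
    isProbabilityMeasure_expMeasure (hlam c)
  have := isProbabilityMeasure_cycleLaw (ν := ν) (hlam 0) (hlam 1)
  rw [← map_unfoldSeq measurable_serviceCycle (map_serviceCycle (hlam 0) (hlam 1) hν),
    ← hM.map_view hlam, Measure.map_map (measurable_unfoldSeq measurable_serviceCycle)
      hM.measurable_view]
  rfl

/-- The delivery cycles are i.i.d. -/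
lemma map_deliverySeq (hM : M.IsMG11 P lam ν) (hlam : ∀ c, 0 < lam c) (hν : ∀ᵐ x ∂ν, 0 ≤ x) :
    P.map M.deliverySeq = iidLaw (deliveryLaw (cycleLaw (lam 0) (lam 1) ν)) := by
  have := isProbabilityMeasure_cycleLaw (ν := ν) (hlam 0) (hlam 1)
  rw [← map_unfoldSeq measurable_deliveryCycle
    (map_deliveryCycle (cycleLaw_source_ne_zero (hlam 0) (hlam 1))), ← hM.map_cycles hlam hν,
    Measure.map_map (measurable_unfoldSeq measurable_deliveryCycle) hM.measurable_cycles]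
  rfl

lemma ae_proper {P : Measure Ω} (hM : M.IsMG11 P lam ν) (hlam : ∀ c, 0 < lam c) (hν : ∀ᵐ x ∂ν, 0 ≤ x) :
    ∀ᵐ ω ∂P, M.Proper ω := by
  have hexp : ∀ c, IsProbabilityMeasure (expMeasure (lam c)) := fun c =>
    isProbabilityMeasure_expMeasure (hlam c)
  have hpts := (hM.measurable_pointSeq 0).prodMk (hM.measurable_pointSeq 1)
  have hmp : MeasurePreserving (fun ω => (M.pointSeq 0 ω, M.pointSeq 1 ω)) P
      ((poissonLaw (lam 0) ν).prod (poissonLaw (lam 1) ν)) := ⟨hpts, hM.map_pointSeq hlam⟩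
  have h0 := hmp.quasiMeasurePreserving.ae (Measure.quasiMeasurePreserving_fst.ae
    (ae_poissonLaw_exists_lt (ν := ν) (hlam 0)))
  have h1 := hmp.quasiMeasurePreserving.ae (Measure.quasiMeasurePreserving_snd.ae
    (ae_poissonLaw_exists_lt (ν := ν) (hlam 1)))
  have h2 : ∀ᵐ ω ∂P, ∀ p, 0 ≤ M.service p ω := ae_all_iff.2 fun p =>
    ae_of_ae_map (hM.measurable_service p).aemeasurable (by rw [hM.service_law p]; exact hν)
  filter_upwards [h0, h1, h2] with ω h0 h1 h2
  refine ⟨fun c => ?_, h2⟩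
  fin_cases c
  exacts [h0, h1]

/-- Each shifted sequence of cycles has the same i.i.d. law, hence contains a hit; so hits occur
beyond every index. -/
lemma ae_regular (hM : M.IsMG11 P lam ν) (hlam : ∀ c, 0 < lam c) (hν : ∀ᵐ x ∂ν, 0 ≤ x) :
    ∀ᵐ ω ∂P, M.Regular ω := by
  have := isProbabilityMeasure_cycleLaw (ν := ν) (hlam 0) (hlam 1)
  have hhit : ∀ᵐ x ∂(iidLaw (cycleLaw (lam 0) (lam 1) ν)), ∀ m, ∃ n, (x (m + n)).1 = 0 :=
    ae_all_iff.2 fun m => (iidLaw_map_shift _ m).quasiMeasurePreserving.ae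
      (ae_exists_hit (cycleLaw_source_ne_zero (hlam 0) (hlam 1)))
  rw [← hM.map_cycles hlam hν] at hhit
  filter_upwards [hM.ae_proper hlam hν, ae_of_ae_map hM.measurable_cycles.aemeasurable hhit]
    with ω h1 h2
  rw [← h1.cycleData_eq] at h2
  refine ⟨h1, Set.infinite_of_forall_exists_gt fun m => ?_⟩
  obtain ⟨n, hn⟩ := h2 (m + 1)
  exact ⟨m + 1 + n, hn, by omega⟩

end StatusUpdateSystem.IsMG11

/-! ### Limit theorems for averages -/

section Averages

lemma tendsto_average_of_even_odd {u : ℕ → ℝ} {m : ℝ}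
    (h0 : Tendsto (fun n : ℕ => (∑ i ∈ Finset.range n, u (2 * i)) / (n : ℝ)) atTop (𝓝 m))
    (h1 : Tendsto (fun n : ℕ => (∑ i ∈ Finset.range n, u (2 * i + 1)) / (n : ℝ)) atTop (𝓝 m)) :
    Tendsto (fun n : ℕ => (∑ i ∈ Finset.range n, u i) / (n : ℝ)) atTop (𝓝 m) := by
  have hsum : ∀ n, ∑ i ∈ Finset.range n, u i
      = ∑ i ∈ Finset.range ((n + 1) / 2), u (2 * i) + ∑ i ∈ Finset.range (n / 2), u (2 * i + 1) := by
    intro n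
    induction n with
    | zero => simp
    | succ n ih =>
      rw [Finset.sum_range_succ, ih]
      rcases Nat.even_or_odd' n with ⟨k, rfl | rfl⟩
      · rw [show (2 * k + 1 + 1) / 2 = k + 1 by omega, show (2 * k + 1) / 2 = k by omega,
          show 2 * k / 2 = k by omega, Finset.sum_range_succ (fun i => u (2 * i))]
        ring
      · rw [show (2 * k + 1 + 1 + 1) / 2 = k + 1 by omega, show (2 * k + 1 + 1) / 2 = k + 1 by omega,
          show (2 * k + 1) / 2 = k by omega, Finset.sum_range_succ (fun i => u (2 * i + 1))]
        ring
  have hc1 : Tendsto (fun n : ℕ => (n + 1) / 2) atTop atTop :=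
    tendsto_atTop.2 fun b => by filter_upwards [eventually_ge_atTop (2 * b)] with n hn; omega
  have hc0 : Tendsto (fun n : ℕ => n / 2) atTop atTop :=
    tendsto_atTop.2 fun b => by filter_upwards [eventually_ge_atTop (2 * b)] with n hn; omega
  have hinv : Tendsto (fun n : ℕ => 1 / (n : ℝ)) atTop (𝓝 0) := tendsto_one_div_atTop_nhds_zero_nat
  have hr0 : Tendsto (fun n : ℕ => ((n / 2 : ℕ) : ℝ) / n) atTop (𝓝 (1 / 2)) := by
    refine tendsto_of_tendsto_of_tendsto_of_le_of_le' (g := fun n : ℕ => 1 / 2 - 1 / (n : ℝ))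
      (by simpa only [sub_zero] using hinv.const_sub (1 / 2)) tendsto_const_nhds ?_ ?_
    all_goals
      filter_upwards [eventually_gt_atTop 0] with n hn
      have hn' : (0 : ℝ) < n := by exact_mod_cast hn
      have h2 : (2 : ℝ) * (n / 2 : ℕ) ≤ n := by exact_mod_cast Nat.mul_div_le n 2
      have h3 : (n : ℝ) ≤ 2 * (n / 2 : ℕ) + 1 := by exact_mod_cast (by omega : n ≤ 2 * (n / 2) + 1)
    · rw [le_div_iff₀ hn', sub_mul, div_mul_cancel₀ _ hn'.ne']
      linarith
    · rw [div_le_iff₀ hn']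
      linarith
  have hr1 : Tendsto (fun n : ℕ => (((n + 1) / 2 : ℕ) : ℝ) / n) atTop (𝓝 (1 / 2)) := by
    refine tendsto_of_tendsto_of_tendsto_of_le_of_le' (h := fun n : ℕ => 1 / 2 + 1 / (n : ℝ))
      tendsto_const_nhds (by simpa only [add_zero] using hinv.const_add (1 / 2)) ?_ ?_
    all_goals
      filter_upwards [eventually_gt_atTop 0] with n hn
      have hn' : (0 : ℝ) < n := by exact_mod_cast hn
      have h2 : (2 : ℝ) * ((n + 1) / 2 : ℕ) ≤ n + 1 := by exact_mod_cast Nat.mul_div_le (n + 1) 2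
      have h3 : (n : ℝ) ≤ 2 * ((n + 1) / 2 : ℕ) := by
        exact_mod_cast (by omega : n ≤ 2 * ((n + 1) / 2))
    · rw [le_div_iff₀ hn']
      linarith
    · rw [div_le_iff₀ hn', add_mul, div_mul_cancel₀ _ hn'.ne']
      linarith
  have h := ((h0.comp hc1).mul hr1).add ((h1.comp hc0).mul hr0)
  rw [show m * (1 / 2) + m * (1 / 2) = m by ring] at h
  refine h.congr' ?_
  filter_upwards [eventually_ge_atTop 2] with n hn
  have p0 : ((n / 2 : ℕ) : ℝ) ≠ 0 := by exact_mod_cast (by omega : n / 2 ≠ 0)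
  have p1 : (((n + 1) / 2 : ℕ) : ℝ) ≠ 0 := by exact_mod_cast (by omega : (n + 1) / 2 ≠ 0)
  have hn' : (n : ℝ) ≠ 0 := by exact_mod_cast (by omega : n ≠ 0)
  simp only [Function.comp_apply]
  rw [hsum, div_mul_div_cancel₀ p1, div_mul_div_cancel₀ p0, add_div]

variable {X : Type*} [MeasurableSpace X]

/-- Strong law of large numbers for nonnegative variables, whose mean may be infinite. -/
lemma strong_law_iidLaw_lintegral (π : Measure X) [IsProbabilityMeasure π] {g : X → ℝ}
    (hg : Measurable g) (hg0 : ∀ a, 0 ≤ g a) :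
    ∀ᵐ x ∂(iidLaw π), Tendsto
      (fun n : ℕ => (∑ i ∈ Finset.range n, ENNReal.ofReal (g (x i))) / (n : ENNReal)) atTop
      (𝓝 (∫⁻ a, ENNReal.ofReal (g a) ∂π)) := by
  have fin : ∀ g : X → ℝ, Measurable g → (∀ a, 0 ≤ g a) → ∫⁻ a, ENNReal.ofReal (g a) ∂π ≠ ⊤ →
      ∀ᵐ x ∂(iidLaw π), Tendsto
      (fun n : ℕ => (∑ i ∈ Finset.range n, ENNReal.ofReal (g (x i))) / (n : ENNReal)) atTop
      (𝓝 (∫⁻ a, ENNReal.ofReal (g a) ∂π)) := by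
    intro g hg hg0 hfin
    have hint : Integrable g π := by
      refine ⟨hg.aestronglyMeasurable, ?_⟩
      rw [hasFiniteIntegral_iff_ofReal (Eventually.of_forall hg0)]
      exact hfin.lt_top
    filter_upwards [strong_law_iidLaw π hg hint] with x hx
    rw [← ofReal_integral_eq_lintegral_ofReal hint (Eventually.of_forall hg0)]
    refine (ENNReal.tendsto_ofReal hx).congr' ?_
    filter_upwards [eventually_gt_atTop 0] with n hn
    rw [ENNReal.ofReal_div_of_pos (by exact_mod_cast hn), ENNReal.ofReal_natCast,
      ENNReal.ofReal_sum_of_nonneg fun i _ => hg0 _]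
  by_cases hfin : ∫⁻ a, ENNReal.ofReal (g a) ∂π = ⊤
  -- When the mean is infinite, the averages dominate those of the variables truncated at `k`, whose
  -- means increase to infinity.
  · have htr : ∀ᵐ x ∂(iidLaw π), ∀ k : ℕ, Tendsto
        (fun n : ℕ => (∑ i ∈ Finset.range n, ENNReal.ofReal (min (g (x i)) k)) / (n : ENNReal)) atTop
        (𝓝 (∫⁻ a, ENNReal.ofReal (min (g a) k) ∂π)) := by
      refine ae_all_iff.2 fun k => fin (fun a => min (g a) k) (by fun_prop)
        (fun a => le_min (hg0 a) k.cast_nonneg) ?_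
      simpa using lintegral_ofReal_min_pow_ne_top (π := π) g k 1
    have hsup := lintegral_ofReal_pow_eq_iSup (π := π) hg 1
    simp only [pow_one] at hsup
    rw [hfin] at hsup ⊢
    filter_upwards [htr] with x hx
    rw [ENNReal.tendsto_nhds_top_iff_nat]
    intro m
    obtain ⟨k, hk⟩ := lt_iSup_iff.1 (hsup ▸ ENNReal.natCast_lt_top m :
      (m : ENNReal) < ⨆ n : ℕ, ∫⁻ a, ENNReal.ofReal (min (g a) n) ∂π)
    filter_upwards [(hx k).eventually_const_lt hk] with n hn
    refine hn.trans_le ?_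
    gcongr
    exact min_le_left _ _
  · exact fin g hg hg0 hfin

/-- Injectivity of `e` means that the pairs use disjoint indices, so they are i.i.d. -/
lemma iidLaw_map_pairs (π : Measure X) [IsProbabilityMeasure π] {e : ℕ × Bool → ℕ}
    (he : Function.Injective e) :
    MeasurePreserving (fun (x : ℕ → X) j => (x (e (j, false)), x (e (j, true)))) (iidLaw π)
      (iidLaw (π.prod π)) := by
  refine ⟨by fun_prop, ?_⟩
  have h1 := Measure.map_infinitePi_infinitePi_of_inj (P := fun _ : ℕ => π) he
  have h2 := Measure.infinitePi_map_curry fun (_ : ℕ) (_ : Bool) => π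
  have hf : (Measure.infinitePi fun _ : Bool => π).map
      (fun y : Bool → X => (y false, y true)) = π.prod π :=
    Measure.infinitePi_map_eval_prod (P := fun _ : Bool => π) (by simp)
  have h3 := Measure.infinitePi_map_pi (fun _ : ℕ => Measure.infinitePi fun _ : Bool => π)
    (f := fun (_ : ℕ) (y : Bool → X) => (y false, y true)) (fun _ => by fun_prop)
  simp_rw [hf] at h3
  change Measure.map _ (Measure.infinitePi fun _ => π) = Measure.infinitePi fun _ => π.prod π
  rw [← h3, ← h2, ← h1, Measure.map_map (by fun_prop) (by fun_prop),
    Measure.map_map (by fun_prop) (by fun_prop)]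
  rfl

/-- Strong law of large numbers for products of consecutive terms. -/
lemma strong_law_iidLaw_mul (π : Measure X) [IsProbabilityMeasure π] {f g : X → ℝ}
    (hf : Measurable f) (hg : Measurable g) (hfi : Integrable f π) (hgi : Integrable g π) :
    ∀ᵐ x ∂(iidLaw π), Tendsto
      (fun n : ℕ => (∑ i ∈ Finset.range n, f (x i) * g (x (i + 1))) / (n : ℝ)) atTop
      (𝓝 ((∫ a, f a ∂π) * ∫ a, g a ∂π)) := by
  -- Neighbouring products share a term and are dependent, but products starting at indices of one
  -- parity are independent. The cases `r = 0` and `r = 1` are then merged.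
  have key : ∀ r : ℕ, ∀ᵐ x ∂(iidLaw π), Tendsto
      (fun n : ℕ => (∑ i ∈ Finset.range n, f (x (2 * i + r)) * g (x (2 * i + r + 1))) / (n : ℝ))
      atTop (𝓝 ((∫ a, f a ∂π) * ∫ a, g a ∂π)) := by
    intro r
    have he : Function.Injective fun q : ℕ × Bool => 2 * q.1 + r + (bif q.2 then 1 else 0) := by
      rintro ⟨i, _ | _⟩ ⟨j, _ | _⟩ h <;> simp only [cond_true, cond_false] at h <;>
        first
        | (exfalso; omega)
        | (obtain rfl : i = j := by omega
           rfl)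
    have := strong_law_iidLaw (π.prod π) (g := fun p => f p.1 * g p.2) (by fun_prop)
      (hfi.mul_prod hgi)
    rw [integral_prod_mul] at this
    exact (iidLaw_map_pairs π he).quasiMeasurePreserving.ae this
  filter_upwards [key 0, key 1] with x h0 h1
  exact tendsto_average_of_even_odd (u := fun i => f (x i) * g (x (i + 1))) h0 h1

lemma exists_mem_Ico_of_tendsto {D : ℕ → ℝ} (hD : Tendsto D atTop atTop) {t : ℝ} (ht : D 0 ≤ t) :
    ∃ n, D n ≤ t ∧ t < D (n + 1) := by
  classical
  have hex : ∃ n, t < D n := (hD.eventually_gt_atTop t).exists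
  have h0 : Nat.find hex ≠ 0 := fun h => by
    have := Nat.find_spec hex
    rw [h] at this
    exact this.not_ge ht
  obtain ⟨n, hn⟩ := Nat.exists_eq_succ_of_ne_zero h0
  refine ⟨n, not_lt.1 (Nat.find_min hex (by omega)), ?_⟩
  have := Nat.find_spec hex
  rwa [hn] at this

/-- Interpolation of averages between the points of an increasing sequence. -/
lemma tendsto_div_of_interpolation {D : ℕ → ℝ} (hmono : StrictMono D) (hD : Tendsto D atTop atTop)
    {I : ℝ → ENNReal} (hI : Monotone I) {L : ENNReal}
    (hlow : Tendsto (fun n => I (D n) / ENNReal.ofReal (D (n + 1))) atTop (𝓝 L))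
    (hup : Tendsto (fun n => I (D (n + 1)) / ENNReal.ofReal (D n)) atTop (𝓝 L)) :
    Tendsto (fun t => I t / ENNReal.ofReal t) atTop (𝓝 L) := by
  -- The index of the interval that contains `t`; it is arbitrary for `t < D 0`, which does not
  -- affect the limit.
  have hex : ∀ t, ∃ n, D 0 ≤ t → D n ≤ t ∧ t < D (n + 1) := fun t => by
    by_cases ht : D 0 ≤ t
    · exact (exists_mem_Ico_of_tendsto hD ht).imp fun n hn _ => hn
    · exact ⟨0, fun h => absurd h ht⟩
  choose N hN using hex
  have hNt : Tendsto N atTop atTop := by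
    refine tendsto_atTop.2 fun b => ?_
    filter_upwards [eventually_ge_atTop (D b), eventually_ge_atTop (D 0)] with t hb ht
    exact Nat.lt_succ_iff.1 (hmono.lt_iff_lt.1 (hb.trans_lt (hN t ht).2))
  refine tendsto_of_tendsto_of_tendsto_of_le_of_le' (hlow.comp hNt) (hup.comp hNt) ?_ ?_
  · filter_upwards [eventually_ge_atTop (D 0)] with t ht
    exact ENNReal.div_le_div (hI (hN t ht).1) (ENNReal.ofReal_le_ofReal (hN t ht).2.le)
  · filter_upwards [eventually_ge_atTop (D 0)] with t ht
    exact ENNReal.div_le_div (hI (hN t ht).2.le) (ENNReal.ofReal_le_ofReal (hN t ht).1)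

end Averages

/-! ### The sample path of the age and its integral -/

namespace StatusUpdateSystem

variable {Ω : Type*} {M : StatusUpdateSystem Ω} {ω : Ω}

namespace Regular

lemma deliverySeq_pos (h : M.Regular ω) (i : ℕ) :
    0 < (M.deliverySeq ω i).1 ∧ 0 ≤ (M.deliverySeq ω i).2 := by
  have key : ∀ s, 0 < (deliveryCycle fun j => M.cycleData ω (s + j)).1.1
      ∧ 0 ≤ (deliveryCycle fun j => M.cycleData ω (s + j)).1.2 := fun s =>
    ⟨Finset.sum_pos (f := fun k => (M.cycleData ω (s + k)).2.1 + (M.cycleData ω (s + k)).2.2)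
      (fun k _ => add_pos_of_pos_of_nonneg (h.cycleData_pos _).1 (h.cycleData_pos _).2)
      Finset.nonempty_range_add_one, (h.cycleData_pos _).2⟩
  rw [deliverySeq, ← h.cycleData_eq, unfoldSeq]
  cases i with
  | zero => simpa using key 0
  | succ i => rw [h.iterate_deliveryCycle]; exact key _

lemma strictMono_deliveryTime (h : M.Regular ω) : StrictMono fun i => M.deliveryTime 0 i ω :=
  strictMono_nat_of_lt_succ fun i => by
    rw [h.deliveryTime_succ]
    linarith [(h.deliverySeq_pos (i + 1)).1]

lemma deliveryTime_eq (h : M.Regular ω) (n : ℕ) : M.deliveryTime 0 n ω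
    = M.busyUntil ω + ∑ i ∈ Finset.range (n + 1), (M.deliverySeq ω i).1 := by
  induction n with
  | zero => simp [h.deliveryTime_zero]
  | succ n ih => rw [h.deliveryTime_succ, ih, Finset.sum_range_succ _ (n + 1), add_assoc]

lemma peakAoI_eq (h : M.Regular ω) (i : ℕ) :
    M.peakAoI 0 i ω = (M.deliverySeq ω (i + 1)).1 + (M.deliverySeq ω i).2 := by
  rw [peakAoI, interdeparture, h.systemTime_eq, h.deliveryTime_succ, add_sub_cancel_left]

/-- Exactly the deliveries `0, …, n` have occurred by time `t`, so the count is `n + 1` and the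
current stamp is that of delivery `n`. -/
lemma aoi_eq (h : M.Regular ω) {n : ℕ} {t : ℝ} (hn : M.deliveryTime 0 n ω ≤ t)
    (hn' : t < M.deliveryTime 0 (n + 1) ω) :
    M.aoi 0 t ω = t - M.deliveryTime 0 n ω + (M.deliverySeq ω n).2 := by
  have hset : {i : ℕ | M.deliveryTime 0 i ω ≤ t} = (Finset.range (n + 1) : Finset ℕ) := by
    ext i
    simp only [Set.mem_ofPred_eq, Finset.coe_range, Set.mem_Iio]
    constructor
    · exact fun hi => h.strictMono_deliveryTime.lt_iff_lt.1 (hi.trans_lt hn')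
    · exact fun hi => (h.strictMono_deliveryTime.monotone (Nat.lt_succ_iff.1 hi)).trans hn
  have hnum : M.numDelivered 0 t ω = n + 1 := by
    rw [numDelivered, hset, Set.ncard_coe_finset, Finset.card_range]
  rw [aoi, timeStamp, hnum, if_neg (by omega), Nat.add_sub_cancel, ← h.systemTime_eq, systemTime]
  ring

/-- Before the first delivery the stamp is one of two initial values. A crude bound suffices: this
stretch has to contribute a finite amount, which vanishes in the average. -/
lemma aoi_le (h : M.Regular ω) {t : ℝ} (ht : t < M.deliveryTime 0 0 ω) :
    M.aoi 0 t ω ≤ M.deliveryTime 0 0 ω + |M.initGen ω| + |M.initStamp ω 0| := by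
  have hset : {i : ℕ | M.deliveryTime 0 i ω ≤ t} = ∅ := by
    ext i
    simp only [Set.mem_ofPred_eq, Set.mem_empty_iff_false, iff_false, not_le]
    exact ht.trans_le (h.strictMono_deliveryTime.monotone (Nat.zero_le i))
  have hnum : M.numDelivered 0 t ω = 0 := by rw [numDelivered, hset, Set.ncard_empty]
  rw [aoi, timeStamp, if_pos hnum]
  split_ifs
  · linarith [neg_abs_le (M.initGen ω), abs_nonneg (M.initStamp ω 0)]
  · linarith [neg_abs_le (M.initStamp ω 0), abs_nonneg (M.initGen ω)]

lemma lintegral_Ico_ofReal_sub_add (d s : ℝ) {y : ℝ} (hs : 0 ≤ s) (hy : 0 ≤ y) :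
    ∫⁻ τ in Set.Ico d (d + y), ENNReal.ofReal (τ - d + s)
      = ENNReal.ofReal (s * y) + ENNReal.ofReal (y ^ 2) / 2 := by
  have hint : IntervalIntegrable (fun τ => τ - d + s) volume d (d + y) :=
    Continuous.intervalIntegrable (by fun_prop) _ _
  have h0 : 0 ≤ᵐ[volume.restrict (Set.Ioc d (d + y))] fun τ => τ - d + s := by
    filter_upwards [ae_restrict_mem measurableSet_Ioc] with τ hτ
    have := hτ.1
    change 0 ≤ τ - d + s
    linarith
  rw [setLIntegral_congr Ico_ae_eq_Ioc, ← ofReal_integral_eq_lintegral_ofReal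
    ((intervalIntegrable_iff_integrableOn_Ioc_of_le (by linarith)).1 hint) h0,
    ← intervalIntegral.integral_of_le (by linarith), ← ENNReal.ofReal_ofNat 2,
    ← ENNReal.ofReal_div_of_pos (by norm_num), ← ENNReal.ofReal_add (by positivity)
    (by positivity)]
  congr 1
  have : ∫ τ in d..(d + y), (τ - d + s) = ∫ τ in d..(d + y), (τ - (d - s)) := by
    congr 1; ext τ; ring
  rw [this, intervalIntegral.integral_sub (by simp) (by simp), integral_id,
    intervalIntegral.integral_const, smul_eq_mul]
  ring

lemma lintegral_aoi_first_ne_top (h : M.Regular ω) :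
    ∫⁻ τ in Set.Icc 0 (M.deliveryTime 0 0 ω), ENNReal.ofReal (M.aoi 0 τ ω) ≠ ⊤ := by
  rw [← setLIntegral_congr Ico_ae_eq_Icc]
  refine ne_top_of_le_ne_top (b := ∫⁻ _ in Set.Ico 0 (M.deliveryTime 0 0 ω), ENNReal.ofReal
    (M.deliveryTime 0 0 ω + |M.initGen ω| + |M.initStamp ω 0|)) ?_ ?_
  · rw [setLIntegral_const, Real.volume_Ico]
    exact ENNReal.mul_ne_top ENNReal.ofReal_ne_top ENNReal.ofReal_ne_top
  · exact setLIntegral_mono measurable_const fun τ hτ => ENNReal.ofReal_le_ofReal (h.aoi_le hτ.2)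

/-- The area under the age splits at the deliveries into an initial piece and trapezoids, each a
rectangle of height the last system time plus a triangle. -/
lemma lintegral_aoi_deliveryTime (h : M.Regular ω) (hb : 0 ≤ M.busyUntil ω) (n : ℕ) :
    ∫⁻ τ in Set.Icc 0 (M.deliveryTime 0 n ω), ENNReal.ofReal (M.aoi 0 τ ω)
      = (∫⁻ τ in Set.Icc 0 (M.deliveryTime 0 0 ω), ENNReal.ofReal (M.aoi 0 τ ω))
        + (∑ i ∈ Finset.range n,
            ENNReal.ofReal ((M.deliverySeq ω i).2 * (M.deliverySeq ω (i + 1)).1)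
          + (∑ i ∈ Finset.range n, ENNReal.ofReal ((M.deliverySeq ω (i + 1)).1 ^ 2)) / 2) := by
  simp only [← setLIntegral_congr (Ico_ae_eq_Icc (μ := volume) (a := (0 : ℝ)))]
  have hnn : ∀ n, 0 ≤ M.deliveryTime 0 n ω := fun n => by
    rw [h.deliveryTime_eq]
    exact add_nonneg hb (Finset.sum_nonneg fun i _ => (h.deliverySeq_pos i).1.le)
  induction n with
  | zero => simp
  | succ n ih =>
    have hlt := h.strictMono_deliveryTime (Nat.lt_succ_self n)
    have hpiece : ∫⁻ τ in Set.Ico (M.deliveryTime 0 n ω) (M.deliveryTime 0 (n + 1) ω),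
        ENNReal.ofReal (M.aoi 0 τ ω)
        = ENNReal.ofReal ((M.deliverySeq ω n).2 * (M.deliverySeq ω (n + 1)).1)
          + ENNReal.ofReal ((M.deliverySeq ω (n + 1)).1 ^ 2) / 2 := by
      rw [← lintegral_Ico_ofReal_sub_add (M.deliveryTime 0 n ω) _ (h.deliverySeq_pos n).2
        (h.deliverySeq_pos (n + 1)).1.le, ← h.deliveryTime_succ]
      exact setLIntegral_congr_fun measurableSet_Ico fun τ hτ => by
        rw [h.aoi_eq hτ.1 hτ.2]
    rw [← Set.Ico_union_Ico_eq_Ico (hnn n) hlt.le, lintegral_union measurableSet_Ico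
      (Set.Ico_disjoint_Ico_same), ih, hpiece, Finset.sum_range_succ, Finset.sum_range_succ,
      ENNReal.add_div]
    ring

end Regular

end StatusUpdateSystem

/-! ### Renewal–reward limit along a fixed path -/

namespace StatusUpdateSystem.Regular

variable {Ω : Type*} {M : StatusUpdateSystem Ω} {ω : Ω}

lemma tendsto_deliveryTime_div (h : M.Regular ω) {m : ℝ}
    (hY : Tendsto (fun n : ℕ => (∑ i ∈ Finset.range n, (M.deliverySeq ω i).1) / (n : ℝ)) atTop
      (𝓝 m)) :
    Tendsto (fun n : ℕ => M.deliveryTime 0 n ω / ((n + 1 : ℕ) : ℝ)) atTop (𝓝 m) := by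
  have h1 := hY.comp (tendsto_add_atTop_nat 1)
  have h2 := (tendsto_const_div_atTop_nhds_zero_nat (M.busyUntil ω)).comp (tendsto_add_atTop_nat 1)
  have h3 := h2.add h1
  rw [zero_add] at h3
  refine h3.congr fun n => ?_
  simp only [Function.comp_apply]
  rw [h.deliveryTime_eq, add_div]

lemma tendsto_average_aoi (h : M.Regular ω) (hb : 0 ≤ M.busyUntil ω) {m c : ℝ} {e : ENNReal}
    (hm : 0 < m)
    (hY : Tendsto (fun n : ℕ => (∑ i ∈ Finset.range n, (M.deliverySeq ω i).1) / (n : ℝ)) atTop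
      (𝓝 m))
    (hSY : Tendsto (fun n : ℕ => (∑ i ∈ Finset.range n,
      (M.deliverySeq ω i).2 * (M.deliverySeq ω (i + 1)).1) / (n : ℝ)) atTop (𝓝 c))
    (hY2 : Tendsto (fun n : ℕ => (∑ i ∈ Finset.range n,
      ENNReal.ofReal ((M.deliverySeq ω (i + 1)).1 ^ 2)) / (n : ENNReal)) atTop (𝓝 e)) :
    Tendsto (fun t : ℝ => (∫⁻ τ in Set.Icc 0 t, ENNReal.ofReal (M.aoi 0 τ ω)) / ENNReal.ofReal t)
      atTop (𝓝 ((ENNReal.ofReal c + e / 2) / ENNReal.ofReal m)) := by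
  set I : ℝ → ENNReal := fun t => ∫⁻ τ in Set.Icc 0 t, ENNReal.ofReal (M.aoi 0 τ ω) with hI
  have hD1 := h.tendsto_deliveryTime_div hY
  have hDtop : Tendsto (fun n => M.deliveryTime 0 n ω) atTop atTop := by
    have := hD1.pos_mul_atTop hm
      ((tendsto_natCast_atTop_atTop (R := ℝ)).comp (tendsto_add_atTop_nat 1))
    refine this.congr fun n => ?_
    simp only [Function.comp_apply]
    exact div_mul_cancel₀ _ (by positivity)
  -- `hD1` divides delivery time `n + 1` by `n + 2`; this factor changes the divisor to `n`, the one
  -- used for the integral.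
  have hone : Tendsto (fun n : ℕ => ((n + 1 + 1 : ℕ) : ℝ) / n) atTop (𝓝 1) := by
    have := (tendsto_const_div_atTop_nhds_zero_nat (2 : ℝ)).const_add 1
    rw [add_zero] at this
    refine this.congr' ?_
    filter_upwards [eventually_gt_atTop 0] with n hn
    have : (n : ℝ) ≠ 0 := by positivity
    push_cast
    field_simp
    ring
  have hD2 : Tendsto (fun n : ℕ => M.deliveryTime 0 (n + 1) ω / (n : ℝ)) atTop (𝓝 m) := by
    have := (hD1.comp (tendsto_add_atTop_nat 1)).mul hone
    rw [mul_one] at this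
    refine this.congr fun n => ?_
    simp only [Function.comp_apply]
    exact div_mul_div_cancel₀ (by positivity)
  have hIn : Tendsto (fun n : ℕ => I (M.deliveryTime 0 n ω) / (n : ENNReal)) atTop
      (𝓝 (ENNReal.ofReal c + e / 2)) := by
    have h1 : Tendsto (fun n : ℕ => I (M.deliveryTime 0 0 ω) / (n : ENNReal)) atTop (𝓝 0) := by
      have := ENNReal.Tendsto.const_mul ENNReal.tendsto_inv_nat_nhds_zero
        (Or.inr h.lintegral_aoi_first_ne_top)
      rw [mul_zero] at this
      exact this
    have h2 : Tendsto (fun n : ℕ => (∑ i ∈ Finset.range n, ENNReal.ofReal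
        ((M.deliverySeq ω i).2 * (M.deliverySeq ω (i + 1)).1)) / (n : ENNReal)) atTop
        (𝓝 (ENNReal.ofReal c)) := by
      refine (ENNReal.tendsto_ofReal hSY).congr' ?_
      filter_upwards [eventually_gt_atTop 0] with n hn
      rw [ENNReal.ofReal_div_of_pos (by exact_mod_cast hn), ENNReal.ofReal_natCast,
        ENNReal.ofReal_sum_of_nonneg fun i _ =>
          mul_nonneg (h.deliverySeq_pos i).2 (h.deliverySeq_pos (i + 1)).1.le]
    have h3 := ENNReal.Tendsto.div_const hY2 (b := 2) (Or.inr (by norm_num))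
    have h4 := h1.add (h2.add h3)
    rw [zero_add] at h4
    refine h4.congr fun n => ?_
    rw [hI]
    dsimp only
    rw [h.lintegral_aoi_deliveryTime hb n]
    simp only [div_eq_mul_inv, add_mul]
    ring
  have hmne : ENNReal.ofReal m ≠ 0 := (ENNReal.ofReal_pos.2 hm).ne'
  have hcancel : ∀ (x : ENNReal) (d : ℝ) (n : ℕ), 0 < n →
      x / (n : ENNReal) / ENNReal.ofReal (d / n) = x / ENNReal.ofReal d := by
    intro x d n hn
    rw [ENNReal.ofReal_div_of_pos (by exact_mod_cast hn), ENNReal.ofReal_natCast,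
      div_eq_mul_inv x, div_eq_mul_inv (ENNReal.ofReal d), ENNReal.mul_div_mul_right _ _
      (ENNReal.inv_ne_zero.2 (ENNReal.natCast_ne_top n))
      (ENNReal.inv_ne_top.2 (by exact_mod_cast hn.ne'))]
  refine tendsto_div_of_interpolation h.strictMono_deliveryTime hDtop
    (fun s t hst => lintegral_mono_set (Set.Icc_subset_Icc_right hst)) ?_ ?_
  · refine (ENNReal.Tendsto.div hIn (Or.inr hmne) (ENNReal.tendsto_ofReal hD2)
      (Or.inl ENNReal.ofReal_ne_top)).congr' ?_
    filter_upwards [eventually_gt_atTop 0] with n hn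
    exact hcancel _ _ n hn
  · refine (ENNReal.Tendsto.div (hIn.comp (tendsto_add_atTop_nat 1)) (Or.inr hmne)
      (ENNReal.tendsto_ofReal hD1) (Or.inl ENNReal.ofReal_ne_top)).congr fun n => ?_
    exact hcancel _ _ (n + 1) n.succ_pos

end StatusUpdateSystem.Regular

/-! ### Evaluation of the constants -/

section Constants

variable {a b mu : ℝ} {ν : Measure ℝ} [IsProbabilityMeasure ν]

/-- The Bochner integral of a non-integrable function is `0`, which differs from `1 / mu`. -/
lemma integrable_service {ν : Measure ℝ} (hmu : 0 < mu) (hmean : ∫ x, x ∂ν = 1 / mu) :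
    Integrable (fun x => x) ν := by
  by_contra hint
  rw [integral_undef hint] at hmean
  exact absurd hmean (by positivity)

lemma lintegral_service {ν : Measure ℝ} (hmu : 0 < mu) (hν : ∀ᵐ x ∂ν, 0 ≤ x) (hmean : ∫ x, x ∂ν = 1 / mu) :
    ∫⁻ x, ENNReal.ofReal x ∂ν = ENNReal.ofReal (1 / mu) := by
  rw [← hmean, ofReal_integral_eq_lintegral_ofReal (integrable_service hmu hmean) hν]

lemma lintegral_fst_deliveryLaw (ha : 0 < a) (hb : 0 < b) (hmu : 0 < mu)
    (hν : ∀ᵐ x ∂ν, 0 ≤ x) (hmean : ∫ x, x ∂ν = 1 / mu) :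
    ∫⁻ w, ENNReal.ofReal w.1 ∂(deliveryLaw (cycleLaw a b ν))
      = ENNReal.ofReal ((a + b + mu) / (a * mu)) := by
  have h := mul_lintegral_deliveryLaw (ν := ν) ha hb hν
  rw [lintegral_ofReal_add_expMeasure (add_pos ha hb) hν, lintegral_service hmu hν hmean,
    ← ENNReal.ofReal_add (by positivity) (by positivity)] at h
  have hp : ENNReal.ofReal (a / (a + b)) ≠ 0 := (ENNReal.ofReal_pos.2 (by positivity)).ne'
  refine (ENNReal.mul_right_inj hp ENNReal.ofReal_ne_top).1 (h.trans ?_)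
  rw [← ENNReal.ofReal_mul (by positivity)]
  congr 1
  field_simp
  ring

lemma integrable_fst_deliveryLaw (ha : 0 < a) (hb : 0 < b) (hmu : 0 < mu)
    (hν : ∀ᵐ x ∂ν, 0 ≤ x) (hmean : ∫ x, x ∂ν = 1 / mu) :
    Integrable (fun w : ℝ × ℝ => w.1) (deliveryLaw (cycleLaw a b ν)) ∧
      ∫ w, w.1 ∂(deliveryLaw (cycleLaw a b ν)) = (a + b + mu) / (a * mu) := by
  have h := lintegral_fst_deliveryLaw ha hb hmu hν hmean
  have h0 : 0 ≤ᵐ[deliveryLaw (cycleLaw a b ν)] fun w => w.1 := by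
    filter_upwards [ae_deliveryLaw_pos ha hb hν] with w hw using hw.1.le
  constructor
  · refine ⟨measurable_fst.aestronglyMeasurable, ?_⟩
    rw [hasFiniteIntegral_iff_ofReal h0, h]
    exact ENNReal.ofReal_lt_top
  · rw [integral_eq_lintegral_of_nonneg_ae h0 measurable_fst.aestronglyMeasurable, h,
      ENNReal.toReal_ofReal (by positivity)]

lemma integrable_snd_deliveryLaw (ha : 0 < a) (hb : 0 < b) (hmu : 0 < mu)
    (hmean : ∫ x, x ∂ν = 1 / mu) :
    Integrable (fun w : ℝ × ℝ => w.2) (deliveryLaw (cycleLaw a b ν)) ∧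
      ∫ w, w.2 ∂(deliveryLaw (cycleLaw a b ν)) = 1 / mu := by
  have hmp : MeasurePreserving (Prod.snd : ℝ × ℝ → ℝ) (deliveryLaw (cycleLaw a b ν)) ν :=
    ⟨measurable_snd, map_snd_deliveryLaw ha hb⟩
  refine ⟨hmp.integrable_comp_of_integrable (integrable_service hmu hmean), ?_⟩
  rw [← hmean]
  conv_rhs => rw [← hmp.map_eq]
  exact (integral_map measurable_snd.aemeasurable aestronglyMeasurable_id).symm

/-- Inserts the second-moment equation into the renewal–reward quotient. The second moment of the
service time may be `⊤`, so it stays a separate `ENNReal` summand while all finite constants are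
collected in one real number. -/
lemma averageAoI_eq (ha : 0 < a) (hb : 0 < b) (hmu : 0 < mu)
    (hν : ∀ᵐ x ∂ν, 0 ≤ x) (hmean : ∫ x, x ∂ν = 1 / mu) :
    (ENNReal.ofReal (1 / mu * ((a + b + mu) / (a * mu)))
        + (∫⁻ w, ENNReal.ofReal (w.1 ^ 2) ∂(deliveryLaw (cycleLaw a b ν))) / 2)
        / ENNReal.ofReal ((a + b + mu) / (a * mu))
      = ENNReal.ofReal ((a + b + mu) / (a * mu))
        + ENNReal.ofReal ((a + b) * mu / (2 * (a + b + mu))) * ∫⁻ x, ENNReal.ofReal (x ^ 2) ∂ν := by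
  have h := mul_lintegral_sq_deliveryLaw (ν := ν) ha hb hν
  rw [lintegral_ofReal_add_sq_expMeasure (add_pos ha hb) hν,
    lintegral_ofReal_add_expMeasure (add_pos ha hb) hν, lintegral_service hmu hν hmean,
    lintegral_fst_deliveryLaw ha hb hmu hν hmean] at h
  have hsq : ∫⁻ w, ENNReal.ofReal (w.1 ^ 2) ∂(deliveryLaw (cycleLaw a b ν))
      = ∫⁻ w, ENNReal.ofReal w.1 ^ 2 ∂(deliveryLaw (cycleLaw a b ν)) := by
    refine lintegral_congr_ae ?_
    filter_upwards [ae_deliveryLaw_pos ha hb hν] with w hw using ENNReal.ofReal_pow hw.1.le 2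
  rw [hsq]
  set e := ∫⁻ w, ENNReal.ofReal w.1 ^ 2 ∂(deliveryLaw (cycleLaw a b ν))
  set s := ∫⁻ x, ENNReal.ofReal (x ^ 2) ∂ν
  -- The finite part of `p * E (Y ^ 2)`: everything except the second moment of the service time.
  set c : ℝ := 2 / (a + b) ^ 2 + 2 * (1 / (a + b)) * (1 / mu)
    + b / (a + b) * (2 * (1 / (a + b) + 1 / mu) * ((a + b + mu) / (a * mu))) with hc
  have hc0 : 0 ≤ c := by positivity
  have h' : ENNReal.ofReal (a / (a + b)) * e = ENNReal.ofReal c + s := by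
    rw [h, hc, ← ENNReal.ofReal_ofNat 2, ← ENNReal.ofReal_add (by positivity) (by positivity),
      ← ENNReal.ofReal_mul (by positivity), ← ENNReal.ofReal_mul (by positivity),
      ← ENNReal.ofReal_mul (by positivity), ← ENNReal.ofReal_mul (by positivity),
      ← ENNReal.ofReal_mul (by positivity), ← ENNReal.ofReal_add (by positivity) (by positivity),
      add_right_comm, ← ENNReal.ofReal_add (by positivity) (by positivity)]
  have he : e = ENNReal.ofReal ((a + b) / a) * (ENNReal.ofReal c + s) := by
    rw [← h', ← mul_assoc, ← ENNReal.ofReal_mul (by positivity), div_mul_div_cancel₀ ha.ne',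
      div_self (by positivity), ENNReal.ofReal_one, one_mul]
  have hm : 0 < (a + b + mu) / (a * mu) := by positivity
  have h2 : (2 : ENNReal)⁻¹ = ENNReal.ofReal (1 / 2) := by
    rw [one_div, ENNReal.ofReal_inv_of_pos (by norm_num), ENNReal.ofReal_ofNat]
  have hring : ∀ u v w x : ℝ, 0 ≤ u → 0 ≤ v → 0 ≤ w → 0 ≤ x →
      (ENNReal.ofReal u + ENNReal.ofReal v * (ENNReal.ofReal c + s) * ENNReal.ofReal w)
        * ENNReal.ofReal x = ENNReal.ofReal ((u + v * c * w) * x) + ENNReal.ofReal (v * w * x) * s := by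
    intro u v w x hu hv hw hx
    rw [ENNReal.ofReal_mul (by positivity), ENNReal.ofReal_mul (by positivity),
      ENNReal.ofReal_mul hv, ENNReal.ofReal_add hu (by positivity),
      ENNReal.ofReal_mul (by positivity), ENNReal.ofReal_mul hv]
    ring
  rw [he, div_eq_mul_inv, ← ENNReal.ofReal_inv_of_pos hm, div_eq_mul_inv _ (2 : ENNReal), h2,
    hring _ _ _ _ (by positivity) (by positivity) (by positivity) (by positivity)]
  congr 2
  · rw [hc]
    field_simp
    ring
  · field_simp

end Constants

/-! ### From time averages to the stationary mean -/

section Stationary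

variable {Ω : Type*} [MeasurableSpace Ω] {P : Measure Ω} [IsProbabilityMeasure P]

lemma lintegral_average_of_stationary {X : ℝ → Ω → ℝ} (hX : Measurable (Function.uncurry X))
    (hst : ∀ t, 0 ≤ t → IdentDistrib (X t) (X 0) P P) {g : ℝ → ENNReal} (hg : Measurable g)
    {n : ℕ} (hn : 0 < n) :
    ∫⁻ ω, (∫⁻ τ in Set.Icc 0 (n : ℝ), g (X τ ω)) / ENNReal.ofReal n ∂P = ∫⁻ ω, g (X 0 ω) ∂P := by
  have hm : Measurable (Function.uncurry fun ω τ => g (X τ ω)) :=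
    hg.comp (hX.comp measurable_swap)
  have hn0 : ENNReal.ofReal n ≠ 0 := (ENNReal.ofReal_pos.2 (by exact_mod_cast hn)).ne'
  simp_rw [div_eq_mul_inv]
  rw [lintegral_mul_const' _ _ (ENNReal.inv_ne_top.2 hn0), lintegral_lintegral_swap hm.aemeasurable,
    setLIntegral_congr_fun (f := fun τ => ∫⁻ ω, g (X τ ω) ∂P)
      (g := fun _ => ∫⁻ ω, g (X 0 ω) ∂P) measurableSet_Icc
      fun τ hτ => ((hst τ hτ.1).comp hg).lintegral_eq,
    setLIntegral_const, Real.volume_Icc, sub_zero, mul_assoc,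
    ENNReal.mul_inv_cancel hn0 ENNReal.ofReal_ne_top, mul_one]

/-- If the time averages of a nonnegative process with constant marginal law converge to a
constant, then this constant is the mean of the process. -/
lemma lintegral_eq_of_stationary {X : ℝ → Ω → ℝ} (hX : Measurable (Function.uncurry X))
    (hst : ∀ t, 0 ≤ t → IdentDistrib (X t) (X 0) P P) {L : ENNReal}
    (hL : ∀ᵐ ω ∂P, Tendsto (fun t : ℝ =>
      (∫⁻ τ in Set.Icc 0 t, ENNReal.ofReal (X τ ω)) / ENNReal.ofReal t) atTop (𝓝 L))
    {t : ℝ} (ht : 0 ≤ t) : ∫⁻ ω, ENNReal.ofReal (X t ω) ∂P = L := by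
  have hX0 : Measurable (X 0) := hX.comp measurable_prodMk_left
  have hL' : ∀ᵐ ω ∂P, Tendsto (fun n : ℕ =>
      (∫⁻ τ in Set.Icc 0 (n : ℝ), ENNReal.ofReal (X τ ω)) / ENNReal.ofReal n) atTop (𝓝 L) := by
    filter_upwards [hL] with ω hω using hω.comp tendsto_natCast_atTop_atTop
  have havg : ∀ n : ℕ, Measurable fun ω =>
      (∫⁻ τ in Set.Icc 0 (n : ℝ), ENNReal.ofReal (X τ ω)) / ENNReal.ofReal n := fun n =>
    (Measurable.lintegral_prod_left' (f := fun p : ℝ × Ω => ENNReal.ofReal (X p.1 p.2))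
      hX.ennreal_ofReal).div_const _
  have h0 : ∫⁻ ω, ENNReal.ofReal (X t ω) ∂P = ∫⁻ ω, ENNReal.ofReal (X 0 ω) ∂P :=
    ((hst t ht).comp ENNReal.measurable_ofReal).lintegral_eq
  rw [h0]
  refine le_antisymm ?_ ?_
  -- Upper bound: the mean of the process truncated at `k` equals that of its time average, which is
  -- at most the time average of the process capped at `k`. By dominated convergence the capped
  -- averages tend to `min L k`.
  · have hsup := lintegral_ofReal_pow_eq_iSup (π := P) hX0 1
    simp only [pow_one] at hsup
    rw [hsup]
    refine iSup_le fun k => ?_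
    have hlim : Tendsto (fun n : ℕ => ∫⁻ ω, min ((∫⁻ τ in Set.Icc 0 (n : ℝ),
        ENNReal.ofReal (X τ ω)) / ENNReal.ofReal n) k ∂P) atTop (𝓝 (∫⁻ _, min L k ∂P)) := by
      refine tendsto_lintegral_of_dominated_convergence (fun _ => (k : ENNReal))
        (fun n => (havg n).min measurable_const)
        (fun n => Eventually.of_forall fun ω => min_le_right _ _) (by simp) ?_
      filter_upwards [hL'] with ω hω using hω.min tendsto_const_nhds
    rw [lintegral_const, measure_univ, mul_one] at hlim
    refine le_trans (ge_of_tendsto hlim ?_) (min_le_left _ _)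
    filter_upwards [eventually_gt_atTop 0] with n hn
    rw [← lintegral_average_of_stationary hX hst (g := fun x => ENNReal.ofReal (min x k))
      (by fun_prop) hn]
    refine lintegral_mono fun ω => le_min ?_ ?_
    · exact ENNReal.div_le_div_right
        (lintegral_mono fun τ => ENNReal.ofReal_le_ofReal (min_le_left _ _)) _
    · refine ENNReal.div_le_of_le_mul ?_
      refine (lintegral_mono (g := fun _ => (k : ENNReal)) fun τ => ?_).trans_eq ?_
      · exact (ENNReal.ofReal_le_ofReal (min_le_right _ _)).trans_eq (ENNReal.ofReal_natCast k)
      · rw [setLIntegral_const, Real.volume_Icc, sub_zero]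
  -- Lower bound by Fatou, as each time average has the mean of the process.
  · calc L = ∫⁻ _, L ∂P := by simp
      _ = ∫⁻ ω, liminf (fun n : ℕ => (∫⁻ τ in Set.Icc 0 (n : ℝ),
          ENNReal.ofReal (X τ ω)) / ENNReal.ofReal n) atTop ∂P :=
        lintegral_congr_ae (by filter_upwards [hL'] with ω hω using hω.liminf_eq.symm)
      _ ≤ liminf (fun n : ℕ => ∫⁻ ω, (∫⁻ τ in Set.Icc 0 (n : ℝ),
          ENNReal.ofReal (X τ ω)) / ENNReal.ofReal n ∂P) atTop := lintegral_liminf_le havg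
      _ = ∫⁻ ω, ENNReal.ofReal (X 0 ω) ∂P := by
        refine (tendsto_const_nhds.congr' ?_).liminf_eq
        filter_upwards [eventually_gt_atTop 0] with n hn
        exact (lintegral_average_of_stationary hX hst ENNReal.measurable_ofReal hn).symm

end Stationary

/-! ### Joint measurability of the age in time and outcome -/

namespace StatusUpdateSystem.IsMG11

variable {Ω : Type*} [MeasurableSpace Ω] {M : StatusUpdateSystem Ω} {P : Measure Ω}
  {lam : Fin 2 → ℝ} {ν : Measure ℝ}

lemma measurable_genTime (hM : M.IsMG11 P lam ν) (p : Fin 2 × ℕ) : Measurable (M.genTime p) :=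
  Finset.measurable_fun_sum _ fun k _ => hM.measurable_gap (p.1, k)

lemma measurable_nextPacket (hM : M.IsMG11 P lam ν) {d : Ω → ℝ} (hd : Measurable d) :
    Measurable fun ω => M.nextPacket (d ω) ω := by
  have h : ∀ c, Measurable fun ω => M.nextOfSource c (d ω) ω := fun c =>
    measurable_const.prodMk (measurable_sInf_nat fun n =>
      measurableSet_lt hd (hM.measurable_genTime (c, n)))
  have hg : ∀ c, Measurable fun ω => M.genTime (M.nextOfSource c (d ω) ω) ω := fun c =>
    measurable_apply_countable hM.measurable_genTime (h c)
  exact Measurable.ite (measurableSet_le (hg 0) (hg 1)) (h 0) (h 1)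

lemma measurable_freeTime (hM : M.IsMG11 P lam ν) (k : ℕ) : Measurable (M.freeTime k) := by
  induction k with
  | zero => exact hM.measurable_busyUntil
  | succ k ih =>
    have h := hM.measurable_nextPacket ih
    exact (measurable_apply_countable hM.measurable_genTime h).add
      (measurable_apply_countable hM.measurable_service h)

lemma measurable_served (hM : M.IsMG11 P lam ν) (k : ℕ) : Measurable (M.served k) :=
  hM.measurable_nextPacket (hM.measurable_freeTime k)

lemma measurable_position (hM : M.IsMG11 P lam ν) (c : Fin 2) (i : ℕ) :
    Measurable (M.position c i) :=
  measurable_nth (fun k =>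
    (measurableSet_singleton c).preimage (hM.measurable_served k).fst) i

lemma measurable_deliveredGen (hM : M.IsMG11 P lam ν) (c : Fin 2) (i : ℕ) :
    Measurable (M.deliveredGen c i) :=
  measurable_apply_countable hM.measurable_genTime
    (measurable_apply_countable hM.measurable_served (hM.measurable_position c i))

lemma measurable_deliveryTime (hM : M.IsMG11 P lam ν) (c : Fin 2) (i : ℕ) :
    Measurable (M.deliveryTime c i) :=
  measurable_apply_countable (fun k => hM.measurable_freeTime (k + 1)) (hM.measurable_position c i)

lemma measurable_numDelivered (hM : M.IsMG11 P lam ν) (c : Fin 2) :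
    Measurable fun p : ℝ × Ω => M.numDelivered c p.1 p.2 := by
  refine measurable_ncard.comp (measurable_set_iff.2 fun i => ?_)
  exact measurableSet_setOfPred.1 (measurableSet_le ((hM.measurable_deliveryTime c i).comp
    measurable_snd) measurable_fst)

lemma measurable_aoi (hM : M.IsMG11 P lam ν) (c : Fin 2) :
    Measurable (Function.uncurry (M.aoi c)) := by
  have hnum := hM.measurable_numDelivered c
  have hbusy : Measurable fun p : ℝ × Ω => M.busyUntil p.2 :=
    hM.measurable_busyUntil.comp measurable_snd
  have hinit : Measurable fun p : ℝ × Ω => M.initState p.2 :=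
    hM.measurable_initState.comp measurable_snd
  have hsrc : Measurable fun p : ℝ × Ω => M.initSource p.2 := hinit.snd.fst
  have hgen : Measurable fun p : ℝ × Ω => M.initGen p.2 := hinit.snd.snd.fst
  have hstamp : Measurable fun p : ℝ × Ω => M.initStamp p.2 c :=
    (measurable_pi_apply c).comp hinit.snd.snd.snd
  have hdel : Measurable fun p : ℝ × Ω =>
      M.deliveredGen c (M.numDelivered c p.1 p.2 - 1) p.2 :=
    measurable_apply_countable (f := fun (n : ℕ) (p : ℝ × Ω) => M.deliveredGen c (n - 1) p.2)
      (fun n => (hM.measurable_deliveredGen c (n - 1)).comp measurable_snd) hnum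
  refine measurable_fst.sub (Measurable.ite ((measurableSet_singleton 0).preimage hnum)
    (Measurable.ite ?_ hgen hstamp) hdel)
  exact (measurableSet_lt measurable_const hbusy).inter
    ((measurableSet_le hbusy measurable_fst).inter ((measurableSet_singleton c).preimage hsrc))

end StatusUpdateSystem.IsMG11

end

/-! ### Average age and average peak age -/

namespace StatusUpdateSystem.IsMG11

variable {Ω : Type*} [MeasurableSpace Ω] {M : StatusUpdateSystem Ω} {P : Measure Ω}
  [IsProbabilityMeasure P] {lam : Fin 2 → ℝ} {ν : Measure ℝ} [IsProbabilityMeasure ν] {mu : ℝ}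

lemma ae_tendsto_average_aoi (hM : M.IsMG11 P lam ν) (hlam : ∀ c, 0 < lam c) (hmu : 0 < mu)
    (hν : ∀ᵐ x ∂ν, 0 ≤ x) (hmean : ∫ x, x ∂ν = 1 / mu) :
    ∀ᵐ ω ∂P, Tendsto
      (fun t : ℝ => (∫⁻ τ in Set.Icc 0 t, ENNReal.ofReal (M.aoi 0 τ ω)) / ENNReal.ofReal t)
      atTop (𝓝 (ENNReal.ofReal ((lam 0 + lam 1 + mu) / (lam 0 * mu)) +
        ENNReal.ofReal ((lam 0 + lam 1) * mu / (2 * (lam 0 + lam 1 + mu))) *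
          ∫⁻ x, ENNReal.ofReal (x ^ 2) ∂ν)) := by
  have ha := hlam 0
  have hb := hlam 1
  have := isProbabilityMeasure_cycleLaw (ν := ν) ha hb
  obtain ⟨h1i, h1⟩ := integrable_fst_deliveryLaw ha hb hmu hν hmean
  obtain ⟨h2i, h2⟩ := integrable_snd_deliveryLaw ha hb hmu hmean
  have hY := strong_law_iidLaw _ measurable_fst h1i
  have hSY := strong_law_iidLaw_mul _ measurable_snd measurable_fst h2i h1i
  -- The ramp that starts at delivery `i` has length `Y (i + 1)`, hence the shift by one.
  have hY2 := (iidLaw_map_shift (deliveryLaw (cycleLaw (lam 0) (lam 1) ν))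
    1).quasiMeasurePreserving.ae (strong_law_iidLaw_lintegral _ (g := fun w => w.1 ^ 2)
      (by fun_prop) fun w => sq_nonneg _)
  rw [h1] at hY
  rw [h1, h2] at hSY
  have hlaw : MeasurePreserving M.deliverySeq P _ :=
    ⟨hM.measurable_deliverySeq, hM.map_deliverySeq hlam hν⟩
  rw [← averageAoI_eq ha hb hmu hν hmean]
  filter_upwards [hM.ae_regular hlam hν, hlaw.quasiMeasurePreserving.ae hY,
    hlaw.quasiMeasurePreserving.ae hSY, hlaw.quasiMeasurePreserving.ae hY2] with ω h k1 k2 k3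
  simp only [add_comm 1] at k3
  exact h.tendsto_average_aoi (hM.busyUntil_nonneg ω) (by positivity) k1 k2 k3

lemma integrable_peakAoI (hM : M.IsMG11 P lam ν) (hlam : ∀ c, 0 < lam c) (hmu : 0 < mu)
    (hν : ∀ᵐ x ∂ν, 0 ≤ x) (hmean : ∫ x, x ∂ν = 1 / mu) (i : ℕ) :
    Integrable (M.peakAoI 0 i) P ∧
      ∫ ω, M.peakAoI 0 i ω ∂P = (2 * lam 0 + lam 1 + mu) / (lam 0 * mu) := by
  have ha := hlam 0
  have hb := hlam 1
  have := isProbabilityMeasure_cycleLaw (ν := ν) ha hb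
  obtain ⟨h1i, h1⟩ := integrable_fst_deliveryLaw ha hb hmu hν hmean
  obtain ⟨h2i, h2⟩ := integrable_snd_deliveryLaw ha hb hmu hmean
  have hlaw : MeasurePreserving M.deliverySeq P _ :=
    ⟨hM.measurable_deliverySeq, hM.map_deliverySeq hlam hν⟩
  have hev : ∀ j, MeasurePreserving (fun ω => M.deliverySeq ω j) P
      (deliveryLaw (cycleLaw (lam 0) (lam 1) ν)) := fun j =>
    (measurePreserving_eval_infinitePi
      (fun _ : ℕ => deliveryLaw (cycleLaw (lam 0) (lam 1) ν)) j).comp hlaw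
  have hpeak : M.peakAoI 0 i
      =ᵐ[P] fun ω => (M.deliverySeq ω (i + 1)).1 + (M.deliverySeq ω i).2 := by
    filter_upwards [hM.ae_regular hlam hν] with ω h using h.peakAoI_eq i
  have i1 : Integrable (fun ω => (M.deliverySeq ω (i + 1)).1) P :=
    (hev (i + 1)).integrable_comp_of_integrable h1i
  have i2 : Integrable (fun ω => (M.deliverySeq ω i).2) P :=
    (hev i).integrable_comp_of_integrable h2i
  refine ⟨(i1.add i2).congr hpeak.symm, ?_⟩
  have e1 : ∫ ω, (M.deliverySeq ω (i + 1)).1 ∂P = (lam 0 + lam 1 + mu) / (lam 0 * mu) := by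
    rw [← h1]
    conv_rhs => rw [← (hev (i + 1)).map_eq]
    exact (integral_map (hev (i + 1)).measurable.aemeasurable
      measurable_fst.aestronglyMeasurable).symm
  have e2 : ∫ ω, (M.deliverySeq ω i).2 ∂P = 1 / mu := by
    rw [← h2]
    conv_rhs => rw [← (hev i).map_eq]
    exact (integral_map (hev i).measurable.aemeasurable
      measurable_snd.aestronglyMeasurable).symm
  rw [integral_congr_ae hpeak, integral_add i1 i2, e1, e2]
  field_simp
  ring

lemma ae_tendsto_average_peakAoI (hM : M.IsMG11 P lam ν) (hlam : ∀ c, 0 < lam c) (hmu : 0 < mu)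
    (hν : ∀ᵐ x ∂ν, 0 ≤ x) (hmean : ∫ x, x ∂ν = 1 / mu) :
    ∀ᵐ ω ∂P, Tendsto (fun n : ℕ => (∑ i ∈ Finset.range n, M.peakAoI 0 i ω) / (n : ℝ))
      atTop (𝓝 ((2 * lam 0 + lam 1 + mu) / (lam 0 * mu))) := by
  have ha := hlam 0
  have hb := hlam 1
  have := isProbabilityMeasure_cycleLaw (ν := ν) ha hb
  obtain ⟨h1i, h1⟩ := integrable_fst_deliveryLaw ha hb hmu hν hmean
  obtain ⟨h2i, h2⟩ := integrable_snd_deliveryLaw ha hb hmu hmean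
  have hY := (iidLaw_map_shift (deliveryLaw (cycleLaw (lam 0) (lam 1) ν))
    1).quasiMeasurePreserving.ae (strong_law_iidLaw _ measurable_fst h1i)
  have hS := strong_law_iidLaw _ measurable_snd h2i
  have hlaw : MeasurePreserving M.deliverySeq P _ :=
    ⟨hM.measurable_deliverySeq, hM.map_deliverySeq hlam hν⟩
  filter_upwards [hM.ae_regular hlam hν, hlaw.quasiMeasurePreserving.ae hY,
    hlaw.quasiMeasurePreserving.ae hS] with ω h k1 k2
  have hlim : (2 * lam 0 + lam 1 + mu) / (lam 0 * mu)
      = (lam 0 + lam 1 + mu) / (lam 0 * mu) + 1 / mu := by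
    field_simp
    ring
  rw [h1] at k1
  rw [h2] at k2
  rw [hlim]
  refine (k1.add k2).congr fun n => ?_
  simp only [h.peakAoI_eq, Finset.sum_add_distrib, add_div, add_comm 1]

end StatusUpdateSystem.IsMG11

theorem corollary3 {Ω : Type*} [MeasurableSpace Ω] (P : Measure Ω) [IsProbabilityMeasure P]
    (lam : Fin 2 → ℝ) (hlam : ∀ c, 0 < lam c) (mu : ℝ) (hmu : 0 < mu)
    (ν : Measure ℝ) [IsProbabilityMeasure ν] (hν : ∀ᵐ x ∂ν, 0 ≤ x)
    (hmean : ∫ x, x ∂ν = 1 / mu)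
    (M : StatusUpdateSystem Ω) (hM : M.IsMG11 P lam ν) :
    -- average AoI as the long-run time average
    (∀ᵐ ω ∂P, Tendsto
      (fun t : ℝ => (∫⁻ τ in Set.Icc 0 t, ENNReal.ofReal (M.aoi 0 τ ω)) / ENNReal.ofReal t)
      atTop (𝓝 (ENNReal.ofReal ((lam 0 + lam 1 + mu) / (lam 0 * mu)) +
        ENNReal.ofReal ((lam 0 + lam 1) * mu / (2 * (lam 0 + lam 1 + mu))) *
          ∫⁻ x, ENNReal.ofReal (x ^ 2) ∂ν))) ∧
    -- average AoI as the mean of the AoI in the stationary regime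
    ((∀ t : ℝ, 0 ≤ t → IdentDistrib (M.aoi 0 t) (M.aoi 0 0) P P) →
      ∀ t : ℝ, 0 ≤ t → ∫⁻ ω, ENNReal.ofReal (M.aoi 0 t ω) ∂P =
        (ENNReal.ofReal ((lam 0 + lam 1 + mu) / (lam 0 * mu)) +
        ENNReal.ofReal ((lam 0 + lam 1) * mu / (2 * (lam 0 + lam 1 + mu))) *
          ∫⁻ x, ENNReal.ofReal (x ^ 2) ∂ν)) ∧
    -- average peak AoI as the mean of each peak
    (∀ i : ℕ, Integrable (M.peakAoI 0 i) P ∧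
      ∫ ω, M.peakAoI 0 i ω ∂P = (2 * lam 0 + lam 1 + mu) / (lam 0 * mu)) ∧
    -- average peak AoI as the long-run average over the peaks
    (∀ᵐ ω ∂P, Tendsto (fun n : ℕ => (∑ i ∈ Finset.range n, M.peakAoI 0 i ω) / (n : ℝ))
      atTop (𝓝 ((2 * lam 0 + lam 1 + mu) / (lam 0 * mu)))) := by
  have h1 := hM.ae_tendsto_average_aoi hlam hmu hν hmean
  exact ⟨h1, fun hst t ht => lintegral_eq_of_stationary (hM.measurable_aoi 0) hst h1 ht,
    hM.integrable_peakAoI hlam hmu hν hmean, hM.ae_tendsto_average_peakAoI hlam hmu hν hmean⟩
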